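/- The thickness $\theta(G)$ of a finite simple graph $G$ is the smallest number of planar subgraphs of $G$ whose union is $G$. Let $n_1, n_2 \geq 1$ be integers and let $G = K_{2n_1,2n_2}$ be the complete bipartite graph with parts of sizes $2n_1$ and $2n_2$. Then \[ \theta(G) = \left\lceil \frac{n_1 n_2}{n_1+n_2-1} \right\rceil . \] -/

import Mathlib

namespace GraphThickness

/-- The Euclidean plane. -/
abbrev Plane : Type := EuclideanSpace ℝ (Fin 2)

/-- `A` is a simple (continuous, non-self-intersecting) arc in the plane with end points `x`
and `y`. -/
def IsArc (A : Set Plane) (x y : Plane) : Prop :=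
  ∃ γ : Path x y, Function.Injective γ ∧ Set.range γ = A

/-- A drawing of the graph `G` in the plane without crossings: vertices are distinct points, every
edge is a simple arc joining its two end vertices, no arc passes through a vertex that is not one
of its ends, and two different arcs meet only in vertices. -/
structure PlaneDrawing {V : Type*} (G : SimpleGraph V) where
  /-- the point that represents a vertex -/
  pos : V → Plane
  /-- the arc that represents an edge (only the values at edges of `G` matter) -/
  arc : Sym2 V → Set Plane
  pos_injective : Function.Injective pos
  isArc : ∀ u v : V, G.Adj u v → IsArc (arc s(u, v)) (pos u) (pos v)
  mem_of_pos_mem : ∀ e ∈ G.edgeSet, ∀ w : V, pos w ∈ arc e → w ∈ e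
  inter_subset : ∀ e ∈ G.edgeSet, ∀ f ∈ G.edgeSet, e ≠ f → arc e ∩ arc f ⊆ Set.range pos

/-- A graph is planar if it can be drawn in the plane without crossings. -/
def IsPlanar {V : Type*} (G : SimpleGraph V) : Prop :=
  Nonempty (PlaneDrawing G)

/-- `G` is the union of `k` planar subgraphs. -/
def IsUnionOfPlanar {V : Type*} (G : SimpleGraph V) (k : ℕ) : Prop :=
  ∃ H : Fin k → G.Subgraph, (∀ i, IsPlanar (H i).coe) ∧ ⨆ i, H i = ⊤

/-- The thickness of `G`: the smallest number of planar subgraphs whose union is `G`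
(`⊤` if there is no such finite number). -/
noncomputable def thickness {V : Type*} (G : SimpleGraph V) : ℕ∞ :=
  ⨅ (k : ℕ) (_ : IsUnionOfPlanar G k), (k : ℕ∞)

end GraphThickness

namespace GraphThickness

/-! ### Lower bound: continuous logarithms and their variation -/

section LowerBound
open Set Complex

/-! Lower bound. A planar bipartite graph on V ≥ 3 vertices has at most 2V − 4 edges. Here 2V − 4 =
4(n₁ + n₂ − 1), so k planar subgraphs can cover all 4n₁n₂ edges only if n₁n₂ ≤ k(n₁ + n₂ − 1).

The edge bound for continuous arcs is proved with winding numbers instead of faces. A point p off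
the drawing defines a functional on the cycle space Z: the sum over the edges e of z_e times the
variation of log(γ_e − p). Moving p along a path that misses the drawing changes the coefficients by
a coboundary, which cycles annihilate (`logVar_sub_move`, `sum_mul_of_mem_ker`); crossing e changes
the value by 2πi z_e (`RadialPath.logVar_cross`). So each of the 2E sides of edges carries a
functional, constant along the edge (`RadialPath.logVar_leftShift`) and passed on to the next edge
around a vertex (`exists_next_direction`). If all degrees are at least two, bipartiteness makes four
consecutive sides distinct, so at most E/2 functionals occur, and their differences separate Z
(`four_mul_finrank_add_one_le`). Thus E − V + 1 ≤ dim Z ≤ E/2 − 1. Vertices of degree at most one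
are removed by induction, and arbitrary arcs are first made straight near the vertices
(`nonempty_radialDrawing`).

Upper bound. A staircase in the n₁ × n₂ grid has n₁ + n₂ − 1 cells. Doubling every row and column
turns it into a graph with 4(n₁ + n₂ − 1) edges, which is planar: rows lie on one axis and columns
on the other, the two copies opposite to each other, at distances increasing along the staircase,
and the edges are straight segments (`isPlanar_of_monotone`). Staircases whose steps start at the
multiples of n₂/t, rounded down, cover the grid with t of them as soon as n₁n₂ ≤ t(n₁ + n₂ − 1) and
t ≤ n₂ (`exists_stairCell`). -/

open Classical in
/-- A nonvanishing continuous function on a star-convex set has a continuous logarithm. -/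
theorem exists_continuousOn_log {E : Type*} [NormedAddCommGroup E] [NormedSpace ℝ E] {s : Set E}
    {x₀ : E} (hs : StarConvex ℝ x₀ s) (hx₀ : x₀ ∈ s) {g : E → ℂ} (hg : ContinuousOn g s)
    (h0 : ∀ x ∈ s, g x ≠ 0) :
    ∃ L : E → ℂ, ContinuousOn L s ∧ ∀ x ∈ s, exp (L x) = g x := by
  have hmem : ∀ (t : unitInterval) (x : s), x₀ + (t : ℝ) • ((x : E) - x₀) ∈ s := fun t x =>
    hs.add_smul_sub_mem x.2 t.2.1 t.2.2
  have hcont : Continuous fun q : unitInterval × s =>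
      g (x₀ + (q.1 : ℝ) • ((q.2 : E) - x₀)) := by
    refine hg.comp_continuous ?_ fun q => hmem q.1 q.2
    fun_prop
  -- The contraction to `x₀` gives a homotopy in ℂ∖{0} from the constant `g x₀` to `g`. Its lift
  -- through the covering `exp`, started at `log (g x₀)`, is at time 1 a logarithm of `g`.
  let H : C(unitInterval × s, {z : ℂ // z ≠ 0}) :=
    ⟨fun q => ⟨_, h0 _ (hmem q.1 q.2)⟩, hcont.subtype_mk _⟩
  let f : C(s, ℂ) := ContinuousMap.const _ (log (g x₀))
  have H0 : ∀ a : s, H (0, a) = (fun z : ℂ => (⟨_, z.exp_ne_zero⟩ : {z : ℂ // z ≠ 0})) (f a) := by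
    intro a
    apply Subtype.ext
    simp [H, f, exp_log (h0 _ hx₀)]
  have hl := isCoveringMap_exp.liftHomotopy_lifts H f H0
  refine ⟨fun x => if hx : x ∈ s then isCoveringMap_exp.liftHomotopy H f H0 (1, ⟨x, hx⟩) else 0,
    ?_, fun x hx => ?_⟩
  · rw [continuousOn_iff_continuous_domRestrict]
    have : Continuous fun x : s => isCoveringMap_exp.liftHomotopy H f H0 (1, x) := by fun_prop
    refine this.congr fun x => ?_
    simp
  · have h1 := congrArg Subtype.val (congrFun hl (1, ⟨x, hx⟩))
    simp only [hx, dite_true]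
    refine h1.trans ?_
    simp [H]

/-- A continuous function with constant exponential on a preconnected set is constant there. -/
theorem eq_of_exp_eq_const {E : Type*} [TopologicalSpace E] {s : Set E} (hs : IsPreconnected s)
    {f : E → ℂ} (hf : ContinuousOn f s) {c : ℂ} (hc : ∀ x ∈ s, exp (f x) = c) {x y : E}
    (hx : x ∈ s) (hy : y ∈ s) : f x = f y := by
  refine isCoveringMap_exp.isSeparatedMap.constOn_of_comp
    isCoveringMap_exp.isLocalHomeomorph.isLocallyInjective hs hf ?_ hx hy
  intro a ha b hb
  exact Subtype.ext ((hc a ha).trans (hc b hb).symm)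

/-- Two continuous logarithms of proportional functions on a preconnected set differ by a
constant. -/
theorem sub_eq_sub_of_exp {E : Type*} [TopologicalSpace E] {s : Set E} (hs : IsPreconnected s)
    {f g : E → ℂ} (hf : ContinuousOn f s) (hg : ContinuousOn g s) {c : ℂ}
    (hc : ∀ x ∈ s, exp (f x) = c * exp (g x)) {x y : E} (hx : x ∈ s) (hy : y ∈ s) :
    f x - g x = f y - g y := by
  refine eq_of_exp_eq_const (f := fun z => f z - g z) hs (hf.sub hg) (c := c) (fun z hz => ?_) hx hy
  rw [exp_sub, hc z hz, mul_div_assoc, div_self (exp_ne_zero _), mul_one]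

open Classical in
/-- The variation of a continuous logarithm of `g` on the interval `[a, b]`. -/
noncomputable def logVar (g : ℝ → ℂ) (a b : ℝ) : ℂ :=
  if h : ∃ L : ℝ → ℂ, ContinuousOn L (Icc a b) ∧ ∀ t ∈ Icc a b, exp (L t) = g t then
    h.choose b - h.choose a else 0

/-- Logarithms of one function on an interval differ by a constant, so the choice made in `logVar`
does not matter. -/
theorem logVar_eq {g L : ℝ → ℂ} {a b : ℝ} (hab : a ≤ b) (hL : ContinuousOn L (Icc a b))
    (h : ∀ t ∈ Icc a b, exp (L t) = g t) : logVar g a b = L b - L a := by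
  have hex : ∃ L : ℝ → ℂ, ContinuousOn L (Icc a b) ∧ ∀ t ∈ Icc a b, exp (L t) = g t := ⟨L, hL, h⟩
  rw [logVar, dif_pos hex]
  have h2 := hex.choose_spec
  have := sub_eq_sub_of_exp isPreconnected_Icc h2.1 hL (c := 1)
    (fun t ht => by rw [h2.2 t ht, h t ht, one_mul]) (left_mem_Icc.2 hab) (right_mem_Icc.2 hab)
  linear_combination -this

theorem exists_log_Icc {g : ℝ → ℂ} {a b : ℝ} (hab : a ≤ b) (hg : ContinuousOn g (Icc a b))
    (h0 : ∀ t ∈ Icc a b, g t ≠ 0) :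
    ∃ L : ℝ → ℂ, ContinuousOn L (Icc a b) ∧ ∀ t ∈ Icc a b, exp (L t) = g t :=
  exists_continuousOn_log ((convex_Icc a b).starConvex (left_mem_Icc.2 hab)) (left_mem_Icc.2 hab)
    hg h0

theorem logVar_add {g : ℝ → ℂ} {a b c : ℝ} (hab : a ≤ b) (hbc : b ≤ c)
    (hg : ContinuousOn g (Icc a c)) (h0 : ∀ t ∈ Icc a c, g t ≠ 0) :
    logVar g a b + logVar g b c = logVar g a c := by
  obtain ⟨L, hL, hLe⟩ := exists_log_Icc (hab.trans hbc) hg h0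
  rw [logVar_eq hab (hL.mono (Icc_subset_Icc_right hbc))
      fun t ht => hLe t (Icc_subset_Icc_right hbc ht),
    logVar_eq hbc (hL.mono (Icc_subset_Icc_left hab))
      fun t ht => hLe t (Icc_subset_Icc_left hab ht), logVar_eq (hab.trans hbc) hL hLe]
  ring

theorem logVar_mul_const {g : ℝ → ℂ} {a b : ℝ} (hab : a ≤ b) (hg : ContinuousOn g (Icc a b))
    (h0 : ∀ t ∈ Icc a b, g t ≠ 0) {c : ℂ} (hc : c ≠ 0) :
    logVar (fun t => c * g t) a b = logVar g a b := by
  obtain ⟨L, hL, hLe⟩ := exists_log_Icc hab hg h0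
  rw [logVar_eq hab hL hLe, logVar_eq (L := fun t => log c + L t) hab (continuousOn_const.add hL)]
  · ring
  · intro t ht
    rw [exp_add, exp_log hc, hLe t ht]

theorem logVar_neg {g : ℝ → ℂ} {a b : ℝ} (hab : a ≤ b) (hg : ContinuousOn g (Icc a b))
    (h0 : ∀ t ∈ Icc a b, g t ≠ 0) : logVar (fun t => - g t) a b = logVar g a b := by
  rw [← logVar_mul_const hab hg h0 (neg_ne_zero.2 one_ne_zero)]
  simp

/-- Reversing the parameter changes the sign of the variation. -/
theorem logVar_reverse {g : ℝ → ℂ} {b : ℝ} (hb : 0 ≤ b) (hg : ContinuousOn g (Icc 0 b))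
    (h0 : ∀ t ∈ Icc 0 b, g t ≠ 0) : logVar (fun t => g (b - t)) 0 b = - logVar g 0 b := by
  obtain ⟨L, hL, hLe⟩ := exists_log_Icc hb hg h0
  have hm : MapsTo (fun t : ℝ => b - t) (Icc 0 b) (Icc 0 b) := fun t ht =>
    ⟨by linarith [ht.2], by linarith [ht.1]⟩
  rw [logVar_eq hb hL hLe, logVar_eq (L := fun t => L (b - t)) hb
    (hL.comp (by fun_prop) hm) fun t ht => hLe _ (hm ht)]
  simp

/-- The total variation of a logarithm along the boundary of a rectangle is zero. -/
theorem logVar_rectangle {f : ℝ → ℝ → ℂ} {a b c d : ℝ} (hab : a ≤ b) (hcd : c ≤ d)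
    (hf : ContinuousOn (fun q : ℝ × ℝ => f q.1 q.2) (Icc a b ×ˢ Icc c d))
    (h0 : ∀ s ∈ Icc a b, ∀ t ∈ Icc c d, f s t ≠ 0) :
    logVar (fun s => f s d) a b - logVar (fun s => f s c) a b =
      logVar (f b) c d - logVar (f a) c d := by
  have hmem : ((a, c) : ℝ × ℝ) ∈ Icc a b ×ˢ Icc c d := ⟨left_mem_Icc.2 hab, left_mem_Icc.2 hcd⟩
  obtain ⟨L, hL, hLe⟩ := exists_continuousOn_log
    (((convex_Icc a b).prod (convex_Icc c d)).starConvex hmem) hmem hf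
    (fun q hq => h0 _ hq.1 _ hq.2)
  have hs : ∀ t ∈ Icc c d, ContinuousOn (fun s => L (s, t)) (Icc a b) := fun t ht =>
    hL.comp (by fun_prop) fun s hs => ⟨hs, ht⟩
  have ht : ∀ s ∈ Icc a b, ContinuousOn (fun t => L (s, t)) (Icc c d) := fun s hs =>
    hL.comp (by fun_prop) fun t ht => ⟨hs, ht⟩
  have ha := left_mem_Icc.2 hab
  have hb := right_mem_Icc.2 hab
  have hc := left_mem_Icc.2 hcd
  have hd := right_mem_Icc.2 hcd
  rw [logVar_eq hab (hs d hd) fun s h => hLe (s, d) ⟨h, hd⟩,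
    logVar_eq hab (hs c hc) fun s h => hLe (s, c) ⟨h, hc⟩,
    logVar_eq hcd (ht b hb) fun t h => hLe (b, t) ⟨hb, h⟩,
    logVar_eq hcd (ht a ha) fun t h => hLe (a, t) ⟨ha, h⟩]
  ring

/-- Moving the base point along a path `τ` disjoint from `γ`. -/
theorem logVar_sub_move {γ τ : ℝ → ℂ} {a b c d : ℝ} (hab : a ≤ b) (hcd : c ≤ d)
    (hγ : ContinuousOn γ (Icc a b)) (hτ : ContinuousOn τ (Icc c d))
    (h0 : ∀ s ∈ Icc a b, ∀ t ∈ Icc c d, γ s ≠ τ t) :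
    logVar (fun s => γ s - τ d) a b - logVar (fun s => γ s - τ c) a b =
      logVar (fun t => τ t - γ b) c d - logVar (fun t => τ t - γ a) c d := by
  have ha := left_mem_Icc.2 hab
  have hb := right_mem_Icc.2 hab
  -- On the sides of the rectangle where `s` is fixed only the end points of `γ` enter. For an edge
  -- `γ` the change is therefore a coboundary: a term of its last vertex minus a term of its first.
  have key := logVar_rectangle (f := fun s t => γ s - τ t) hab hcd
    ((hγ.comp continuousOn_fst fun q hq => hq.1).sub (hτ.comp continuousOn_snd fun q hq => hq.2))
    (fun s hs t ht => sub_ne_zero.2 (h0 s hs t ht))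
  rw [key, ← logVar_neg hcd (g := fun t => τ t - γ b) (hτ.sub continuousOn_const)
    (fun t ht => sub_ne_zero.2 (h0 b hb t ht).symm),
    ← logVar_neg hcd (g := fun t => τ t - γ a) (hτ.sub continuousOn_const)
    (fun t ht => sub_ne_zero.2 (h0 a ha t ht).symm)]
  simp

theorem continuousOn_ite_Icc {f g : ℝ → ℂ} {a b c : ℝ} (hab : a ≤ b) (hbc : b ≤ c)
    (hf : ContinuousOn f (Icc a b)) (hg : ContinuousOn g (Icc b c)) (hfg : f b = g b) :
    ContinuousOn (fun t => if t ≤ b then f t else g t) (Icc a c) := by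
  rw [← Icc_union_Icc_eq_Icc hab hbc]
  refine ContinuousOn.union_of_isClosed (hf.congr fun t ht => if_pos ht.2)
    (hg.congr fun t ht => ?_) isClosed_Icc isClosed_Icc
  by_cases h : t ≤ b
  · obtain rfl : t = b := le_antisymm h ht.1
    simpa using hfg
  · exact if_neg h

/-- A quarter turn moves the closed lower half plane without 0 into the closed right half plane, so
one branch of the logarithm covers it, both real rays included. -/
theorem I_mul_mem_slitPlane {w : ℂ} (hw : w ≠ 0) (h : w.im ≤ 0) : I * w ∈ slitPlane := by
  rw [mem_slitPlane_iff]
  simp only [mul_re, I_re, zero_mul, I_im, one_mul, zero_sub, mul_im, zero_add]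
  rcases h.lt_or_eq with h | h
  · left; linarith
  · right
    intro h2
    exact hw (Complex.ext h2 h)

theorem neg_I_mul_mem_slitPlane {w : ℂ} (hw : w ≠ 0) (h : 0 ≤ w.im) : -I * w ∈ slitPlane := by
  have := I_mul_mem_slitPlane (w := -w) (neg_ne_zero.2 hw) (by simpa using h)
  simpa using this

/-! ### Paths with radial ends and their left shifts -/

/-- A path from `a` to `b`, parametrised by `[0, 3]`, which is the straight segment from `a` to
`a + v` on `[0, 1]`, the straight segment from `b + w` to `b` on `[2, 3]`, and outside the open
discs around `a` and `b` of radius `‖v‖` and `‖w‖` in between. -/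
structure RadialPath (γ : ℝ → ℂ) (a b v w : ℂ) : Prop where
  cont : ContinuousOn γ (Icc 0 3)
  inj : InjOn γ (Icc 0 3)
  start : ∀ t ∈ Icc (0 : ℝ) 1, γ t = a + t * v
  finish : ∀ t ∈ Icc (2 : ℝ) 3, γ t = b + (3 - t) * w
  left_ne : v ≠ 0
  right_ne : w ≠ 0
  lt_one : ∀ t ∈ Icc (0 : ℝ) 3, ‖γ t - a‖ < ‖v‖ → t < 1
  two_lt : ∀ t ∈ Icc (0 : ℝ) 3, ‖γ t - b‖ < ‖w‖ → 2 < t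

theorem RadialPath.reverse {γ : ℝ → ℂ} {a b v w : ℂ} (h : RadialPath γ a b v w) :
    RadialPath (fun t => γ (3 - t)) b a w v where
  cont := h.cont.comp (by fun_prop) fun t ht => ⟨by linarith [ht.2], by linarith [ht.1]⟩
  inj := fun s hs t ht hst => by
    have := h.inj (x₁ := 3 - s) (x₂ := 3 - t) ⟨by linarith [hs.2], by linarith [hs.1]⟩
      ⟨by linarith [ht.2], by linarith [ht.1]⟩ hst
    linarith
  start := fun t ht => by
    rw [h.finish _ ⟨by linarith [ht.2], by linarith [ht.1]⟩]
    push_cast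
    ring
  finish := fun t ht => by
    rw [h.start _ ⟨by linarith [ht.2], by linarith [ht.1]⟩]
    push_cast
    ring
  left_ne := h.right_ne
  right_ne := h.left_ne
  lt_one := fun t ht hlt => by
    linarith [h.two_lt (3 - t) ⟨by linarith [ht.2], by linarith [ht.1]⟩ hlt]
  two_lt := fun t ht hlt => by
    linarith [h.lt_one (3 - t) ⟨by linarith [ht.2], by linarith [ht.1]⟩ hlt]

/-- The path which follows `γ`, except that it starts and ends on the left side of `γ`, at angle
`ε` from the radial segments. -/
noncomputable def leftShift (γ : ℝ → ℂ) (a b v w : ℂ) (ε t : ℝ) : ℂ :=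
  if t ≤ 1 / 2 then a + v / 2 * exp ((ε * (1 - 2 * t) : ℝ) * I)
  else if t ≤ 5 / 2 then γ t else b + w / 2 * exp ((-(ε * (2 * t - 5)) : ℝ) * I)

section
variable {γ : ℝ → ℂ} {a b v w : ℂ} {ε : ℝ}

theorem leftShift_of_le {t : ℝ} (ht : t ≤ 1 / 2) :
    leftShift γ a b v w ε t = a + v / 2 * exp ((ε * (1 - 2 * t) : ℝ) * I) := if_pos ht

theorem RadialPath.half (h : RadialPath γ a b v w) : γ (1 / 2) = a + v / 2 := by
  rw [h.start _ ⟨by norm_num, by norm_num⟩]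
  push_cast
  ring

theorem RadialPath.five_halves (h : RadialPath γ a b v w) : γ (5 / 2) = b + w / 2 := by
  rw [h.finish _ ⟨by norm_num, by norm_num⟩]
  push_cast
  ring

theorem RadialPath.leftShift_of_mem (h : RadialPath γ a b v w) {t : ℝ}
    (ht : t ∈ Icc (1 / 2 : ℝ) (5 / 2)) : leftShift γ a b v w ε t = γ t := by
  rw [leftShift]
  split_ifs with h1 h2
  · obtain rfl : t = 1 / 2 := le_antisymm h1 ht.1
    rw [h.half]
    norm_num
  · rfl
  · exact absurd ht.2 h2

theorem RadialPath.leftShift_of_ge (h : RadialPath γ a b v w) {t : ℝ} (ht : 5 / 2 ≤ t) :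
    leftShift γ a b v w ε t = b + w / 2 * exp ((-(ε * (2 * t - 5)) : ℝ) * I) := by
  rw [leftShift, if_neg (by linarith)]
  split_ifs with h2
  · obtain rfl : t = 5 / 2 := le_antisymm h2 ht
    rw [h.five_halves]
    norm_num
  · rfl

theorem RadialPath.leftShift_continuousOn (h : RadialPath γ a b v w) :
    ContinuousOn (leftShift γ a b v w ε) (Icc 0 3) := by
  unfold leftShift
  refine continuousOn_ite_Icc (by norm_num) (by norm_num) (by fun_prop)
    (continuousOn_ite_Icc (by norm_num) (by norm_num)
      (h.cont.mono (Icc_subset_Icc (by norm_num) (by norm_num))) (by fun_prop) ?_) ?_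
  · rw [h.five_halves]; norm_num
  · rw [if_pos (by norm_num), h.half]; norm_num

theorem norm_half_mul_exp (v : ℂ) (x : ℝ) : ‖v / 2 * exp (x * I)‖ = ‖v‖ / 2 := by
  rw [norm_mul, norm_exp_ofReal_mul_I, mul_one, norm_div]
  norm_num

/-- `γ` meets its left shift only where they follow each other. -/
theorem RadialPath.eq_of_eq_leftShift (h : RadialPath γ a b v w) (h0 : 0 < ε) (hπ : ε < Real.pi)
    {s t : ℝ} (hs : s ∈ Icc (0 : ℝ) 3) (ht : t ∈ Icc (0 : ℝ) 3)
    (heq : γ s = leftShift γ a b v w ε t) : s = t ∧ 1 / 2 ≤ t ∧ t ≤ 5 / 2 := by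
  have hv := norm_pos_iff.2 h.left_ne
  have hw := norm_pos_iff.2 h.right_ne
  rcases lt_or_ge t (1 / 2) with h1 | h1
  · exfalso
    rw [leftShift_of_le h1.le] at heq
    have hs1 : s < 1 := h.lt_one s hs (by
      rw [heq, add_sub_cancel_left, norm_half_mul_exp]; linarith)
    rw [h.start s ⟨hs.1, hs1.le⟩] at heq
    have h3 : ((2 * s : ℝ) : ℂ) = exp ((ε * (1 - 2 * t) : ℝ) * I) := by
      apply mul_left_cancel₀ h.left_ne
      push_cast at heq ⊢
      linear_combination 2 * heq
    have h4 := congrArg Complex.im h3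
    rw [ofReal_im, exp_ofReal_mul_I_im] at h4
    have := Real.sin_pos_of_pos_of_lt_pi (x := ε * (1 - 2 * t)) (by
      apply mul_pos h0; linarith) (by nlinarith [ht.1])
    linarith
  rcases le_or_gt t (5 / 2) with h2 | h2
  · rw [h.leftShift_of_mem ⟨h1, h2⟩] at heq
    exact ⟨h.inj hs ht heq, h1, h2⟩
  · exfalso
    rw [h.leftShift_of_ge h2.le] at heq
    have hs1 : 2 < s := h.two_lt s hs (by
      rw [heq, add_sub_cancel_left, norm_half_mul_exp]; linarith)
    rw [h.finish s ⟨hs1.le, hs.2⟩] at heq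
    have h3 : ((2 * (3 - s) : ℝ) : ℂ) = exp ((-(ε * (2 * t - 5)) : ℝ) * I) := by
      apply mul_left_cancel₀ h.right_ne
      push_cast at heq ⊢
      linear_combination 2 * heq
    have h4 := congrArg Complex.im h3
    rw [ofReal_im, exp_ofReal_mul_I_im, Real.sin_neg] at h4
    have := Real.sin_pos_of_pos_of_lt_pi (x := ε * (2 * t - 5)) (by
      apply mul_pos h0; linarith) (by nlinarith [ht.2])
    linarith

/-- The part of the triangle `c ≤ t ≤ s ≤ d` off the diagonal segment over `[1/2, 5/2]`. -/
def lowerTriangle (c d : ℝ) : Set (ℝ × ℝ) :=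
  {q | c ≤ q.2 ∧ q.2 ≤ q.1 ∧ q.1 ≤ d ∧ ¬ (q.1 = q.2 ∧ 1 / 2 ≤ q.2 ∧ q.2 ≤ 5 / 2)}

/-- Points are missing only on the hypotenuse, and a segment from the opposite corner `(d, c)` meets
the hypotenuse at most in its other end. -/
theorem starConvex_lowerTriangle {c d : ℝ} (hcd : c < d) :
    StarConvex ℝ (d, c) (lowerTriangle c d) := by
  rintro ⟨s, t⟩ ⟨h1, h2, h3, h4⟩ x y hx hy hxy
  simp only [lowerTriangle, Prod.smul_mk, Prod.mk_add_mk, smul_eq_mul, mem_ofPred_eq] at *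
  obtain rfl : x = 1 - y := by linarith
  refine ⟨by nlinarith, by nlinarith, by nlinarith, ?_⟩
  rintro ⟨h5, h6⟩
  rcases hx.eq_or_lt with h0 | h0
  · obtain rfl : y = 1 := by linarith
    simp only [sub_self, zero_mul, one_mul, zero_add] at h5 h6
    exact h4 ⟨h5, h6⟩
  · nlinarith [mul_pos h0 (sub_pos.2 hcd), mul_nonneg hy (sub_nonneg.2 h2)]

theorem corner_mem_lowerTriangle {c d : ℝ} (hcd : c < d) : (d, c) ∈ lowerTriangle c d :=
  ⟨le_rfl, hcd.le, le_rfl, fun h => hcd.ne' h.1⟩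

theorem lowerTriangle_subset {c d c' d' : ℝ} (hc : c' ≤ c) (hd : d ≤ d') :
    lowerTriangle c d ⊆ lowerTriangle c' d' := fun _ hq =>
  ⟨hc.trans hq.1, hq.2.1, hq.2.2.1.trans hd, hq.2.2.2⟩

/-- The winding integrals of `γ` around the two ends of its left shift are related as if the
two paths were disjoint. -/
theorem RadialPath.logVar_leftShift (h : RadialPath γ a b v w) (h0 : 0 < ε) (hπ : ε < Real.pi) :
    logVar (fun s => γ s - leftShift γ a b v w ε 3) 0 3 -
      logVar (fun s => γ s - leftShift γ a b v w ε 0) 0 3 =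
    logVar (fun t => leftShift γ a b v w ε t - b) 0 3 -
      logVar (fun t => leftShift γ a b v w ε t - a) 0 3 := by
  set τ := leftShift γ a b v w ε with hτ
  have hτc : ContinuousOn τ (Icc 0 3) := h.leftShift_continuousOn
  have hne : ∀ {s t : ℝ}, s ∈ Icc (0 : ℝ) 3 → t ∈ Icc (0 : ℝ) 3 →
      ¬ (s = t ∧ 1 / 2 ≤ t ∧ t ≤ 5 / 2) → γ s - τ t ≠ 0 := fun hs ht hst he =>
    hst (h.eq_of_eq_leftShift h0 hπ hs ht (sub_eq_zero.1 he))
  have hGc : ContinuousOn (fun q : ℝ × ℝ => γ q.1 - τ q.2) (Icc 0 3 ×ˢ Icc 0 3) :=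
    (h.cont.comp continuousOn_fst fun q hq => hq.1).sub
      (hτc.comp continuousOn_snd fun q hq => hq.2)
  have hU : ∀ {q : ℝ × ℝ}, q ∈ lowerTriangle 0 3 → q ∈ Icc (0 : ℝ) 3 ×ˢ Icc (0 : ℝ) 3 :=
    fun {q} hq => ⟨⟨hq.1.trans hq.2.1, hq.2.2.1⟩, ⟨hq.1, hq.2.1.trans hq.2.2.1⟩⟩
  have hD : ∀ {q : ℝ × ℝ}, q ∈ lowerTriangle 0 3 → q.swap ∈ Icc (0 : ℝ) 3 ×ˢ Icc (0 : ℝ) 3 :=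
    fun {q} hq => ⟨(hU hq).2, (hU hq).1⟩
  have hneU : ∀ q ∈ lowerTriangle 0 3, γ q.1 - τ q.2 ≠ 0 := fun q hq =>
    hne (hU hq).1 (hU hq).2 hq.2.2.2
  have hneD : ∀ q ∈ lowerTriangle 0 3, γ q.2 - τ q.1 ≠ 0 := fun q hq =>
    hne (hU hq).2 (hU hq).1 fun hh => hq.2.2.2 ⟨hh.1.symm, hh.1 ▸ hh.2.1, hh.1 ▸ hh.2.2⟩
  have hDc : ContinuousOn (fun q : ℝ × ℝ => γ q.2 - τ q.1) (lowerTriangle 0 3) :=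
    hGc.comp (f := Prod.swap) continuous_swap.continuousOn fun q hq => hD hq
  -- The zeros of `γ s - τ t` lie on the diagonal over `[1/2, 5/2]`. `LU` is a logarithm on the half
  -- `t ≤ s`, and `LD` on the half `s ≤ t` with the coordinates swapped. The claim amounts to `LU -
  -- LD` having the same value at `(0, 0)` and `(3, 3)`.
  obtain ⟨LU, hLU, hLUe⟩ := exists_continuousOn_log
    (starConvex_lowerTriangle (c := 0) (d := 3) (by norm_num))
    (corner_mem_lowerTriangle (by norm_num)) (hGc.mono fun q hq => hU hq) hneU
  obtain ⟨LD, hLD, hLDe⟩ := exists_continuousOn_log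
    (starConvex_lowerTriangle (c := 0) (d := 3) (by norm_num))
    (corner_mem_lowerTriangle (by norm_num)) hDc hneD
  have hpre : ∀ {c d : ℝ}, c < d → IsPreconnected (lowerTriangle c d) := fun hcd =>
    ((starConvex_lowerTriangle hcd).isPathConnected
      (corner_mem_lowerTriangle hcd)).isConnected.isPreconnected
  -- the boundary of the square
  have e1 : logVar (fun s => γ s - τ 0) 0 3 = LU (3, 0) - LU (0, 0) := by
    refine logVar_eq (L := fun s => LU (s, 0)) (by norm_num) (hLU.comp (by fun_prop) ?_) ?_
    · exact fun s hs => ⟨le_rfl, hs.1, hs.2, fun h => by norm_num at h⟩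
    · exact fun s hs => hLUe (s, 0) ⟨le_rfl, hs.1, hs.2, fun h => by norm_num at h⟩
  have e2 : logVar (fun t => τ t - b) 0 3 = LU (3, 3) - LU (3, 0) := by
    have hm : ∀ t ∈ Icc (0 : ℝ) 3, ((3, t) : ℝ × ℝ) ∈ lowerTriangle 0 3 := fun t ht =>
      ⟨ht.1, ht.2, le_rfl, fun h => by rw [← h.1] at h; norm_num at h⟩
    have hb : γ 3 = b := by rw [h.finish 3 (by norm_num)]; norm_num
    rw [← logVar_neg (g := fun t => τ t - b) (by norm_num) (hτc.sub continuousOn_const)]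
    · refine logVar_eq (L := fun t => LU (3, t)) (by norm_num) (hLU.comp (by fun_prop) hm) ?_
      intro t ht
      rw [hLUe _ (hm t ht), ← hb]
      ring
    · intro t ht
      have := hneU _ (hm t ht)
      rw [← hb]
      exact fun hh => this (by rw [← neg_eq_zero]; simpa using hh)
  have e3 : logVar (fun s => γ s - τ 3) 0 3 = LD (3, 3) - LD (3, 0) := by
    have hm : ∀ t ∈ Icc (0 : ℝ) 3, ((3, t) : ℝ × ℝ) ∈ lowerTriangle 0 3 := fun t ht =>
      ⟨ht.1, ht.2, le_rfl, fun h => by rw [← h.1] at h; norm_num at h⟩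
    exact logVar_eq (L := fun s => LD (3, s)) (by norm_num) (hLD.comp (by fun_prop) hm)
      fun s hs => hLDe _ (hm s hs)
  have e4 : logVar (fun t => τ t - a) 0 3 = LD (3, 0) - LD (0, 0) := by
    have hm : ∀ t ∈ Icc (0 : ℝ) 3, ((t, 0) : ℝ × ℝ) ∈ lowerTriangle 0 3 := fun t ht =>
      ⟨le_rfl, ht.1, ht.2, fun h => by norm_num at h⟩
    have ha : γ 0 = a := by rw [h.start 0 (by norm_num)]; norm_num
    rw [← logVar_neg (g := fun t => τ t - a) (by norm_num) (hτc.sub continuousOn_const)]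
    · refine logVar_eq (L := fun t => LD (t, 0)) (by norm_num) (hLD.comp (by fun_prop) hm) ?_
      intro t ht
      rw [hLDe _ (hm t ht), ← ha]
      ring
    · intro t ht
      have := hneD _ (hm t ht)
      rw [← ha]
      exact fun hh => this (by rw [← neg_eq_zero]; simpa using hh)
  -- the middle part
  have e5 : LU (1, 1 / 2) - LD (1, 1 / 2) = LU (5 / 2, 2) - LD (5 / 2, 2) := by
    have hconv : Convex ℝ {q : ℝ × ℝ | 1 / 2 ≤ q.2 ∧ q.2 < q.1 ∧ q.1 ≤ 5 / 2} := by
      rintro ⟨s, t⟩ ⟨h1, h2, h3⟩ ⟨s', t'⟩ ⟨h1', h2', h3'⟩ x y hx hy hxy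
      simp only [Prod.smul_mk, Prod.mk_add_mk, smul_eq_mul, mem_ofPred_eq] at *
      obtain rfl : x = 1 - y := by linarith
      refine ⟨by nlinarith, ?_, by nlinarith⟩
      rcases hx.eq_or_lt with h0 | h0
      · obtain rfl : y = 1 := by linarith
        linarith
      · nlinarith [mul_pos h0 (sub_pos.2 h2), mul_nonneg hy (sub_pos.2 h2').le]
    have hsub : {q : ℝ × ℝ | 1 / 2 ≤ q.2 ∧ q.2 < q.1 ∧ q.1 ≤ 5 / 2} ⊆ lowerTriangle 0 3 :=
      fun q hq => ⟨by linarith [hq.1], hq.2.1.le, by linarith [hq.2.2], fun hh => hq.2.1.ne' hh.1⟩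
    -- Here `τ` equals `γ`, so exchanging the arguments only changes the sign.
    refine sub_eq_sub_of_exp (c := -1) hconv.isPreconnected (hLU.mono hsub) (hLD.mono hsub) ?_ ?_ ?_
    · intro q hq
      rw [hLUe q (hsub hq), hLDe q (hsub hq),
        hτ, h.leftShift_of_mem ⟨hq.1, by linarith [hq.2.1, hq.2.2]⟩,
        h.leftShift_of_mem ⟨by linarith [hq.1, hq.2.1], hq.2.2⟩]
      ring
    · norm_num
    · norm_num
  -- the two end parts
  have e6 : LU (0, 0) - LD (0, 0) = LU (1, 1 / 2) - LD (1, 1 / 2) +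
      (log (I * (-1 / 2)) - log (I * (1 / 2))) := by
    have hsub := lowerTriangle_subset (c := 0) (d := 1) (c' := 0) (d' := 3) le_rfl (by norm_num)
    -- Near `a` the shift stays weakly to the left of the radius, so the difference divided by `v`
    -- stays in the closed lower half plane. The single branch `log (I * ·)` then compares `LU` with
    -- `LD` around this end of the zero set.
    have him : ∀ s ∈ Icc (0 : ℝ) 1, ∀ t ∈ Icc (0 : ℝ) 1, ((γ s - τ t) / v).im ≤ 0 := by
      intro s hs t ht
      have hv := h.left_ne
      rw [h.start s hs]
      rcases le_total t (1 / 2) with h1 | h1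
      · rw [hτ, leftShift_of_le h1]
        have : (a + s * v - (a + v / 2 * exp ((ε * (1 - 2 * t) : ℝ) * I))) / v =
            (s : ℂ) - (1 / 2 : ℝ) * exp ((ε * (1 - 2 * t) : ℝ) * I) := by
          push_cast
          field_simp
          ring
        rw [this, sub_im, im_ofReal_mul, exp_ofReal_mul_I_im, ofReal_im]
        have := Real.sin_nonneg_of_nonneg_of_le_pi (x := ε * (1 - 2 * t)) (by
          apply mul_nonneg h0.le; linarith) (by nlinarith [ht.1])
        linarith
      · rw [hτ, h.leftShift_of_mem ⟨h1, by linarith [ht.2]⟩, h.start t ht]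
        have : (a + s * v - (a + t * v)) / v = ((s - t : ℝ) : ℂ) := by
          push_cast
          field_simp
          ring
        rw [this, ofReal_im]
    have hval : ∀ s ∈ Icc (1 / 2 : ℝ) 1, ∀ t ∈ Icc (1 / 2 : ℝ) 1, (γ s - τ t) / v = s - t := by
      intro s hs t ht
      have hv := h.left_ne
      rw [h.start s ⟨by linarith [hs.1], hs.2⟩, hτ, h.leftShift_of_mem ⟨ht.1, by linarith [ht.2]⟩,
        h.start t ⟨by linarith [ht.1], ht.2⟩]
      field_simp
      ring
    have hmU : ∀ q ∈ lowerTriangle 0 1, q.1 ∈ Icc (0 : ℝ) 1 ∧ q.2 ∈ Icc (0 : ℝ) 1 := fun q hq =>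
      ⟨⟨hq.1.trans hq.2.1, hq.2.2.1⟩, ⟨hq.1, hq.2.1.trans hq.2.2.1⟩⟩
    have hU' := sub_eq_sub_of_exp (x := (0, 0)) (y := (1, 1 / 2)) (c := v / I)
      (hpre (c := 0) (d := 1) (by norm_num)) (hLU.mono hsub)
      (g := fun q => log (I * ((γ q.1 - τ q.2) / v)))
      ((continuousOn_const.mul ((hGc.mono fun q hq => hU (hsub hq)).div_const v)).clog
        fun q hq => I_mul_mem_slitPlane (div_ne_zero (hneU q (hsub hq)) h.left_ne)
          (him _ (hmU q hq).1 _ (hmU q hq).2))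
      (fun q hq => by
        have hv := h.left_ne
        have hI := I_ne_zero
        rw [hLUe q (hsub hq), exp_log (mul_ne_zero I_ne_zero
          (div_ne_zero (hneU q (hsub hq)) h.left_ne))]
        field_simp)
      (by norm_num [lowerTriangle]) (by norm_num [lowerTriangle])
    have hD' := sub_eq_sub_of_exp (x := (0, 0)) (y := (1, 1 / 2)) (c := v / I)
      (hpre (c := 0) (d := 1) (by norm_num)) (hLD.mono hsub)
      (g := fun q => log (I * ((γ q.2 - τ q.1) / v)))
      ((continuousOn_const.mul ((hDc.mono hsub).div_const v)).clog
        fun q hq => I_mul_mem_slitPlane (div_ne_zero (hneD q (hsub hq)) h.left_ne)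
          (him _ (hmU q hq).2 _ (hmU q hq).1))
      (fun q hq => by
        have hv := h.left_ne
        have hI := I_ne_zero
        rw [hLDe q (hsub hq), exp_log (mul_ne_zero I_ne_zero
          (div_ne_zero (hneD q (hsub hq)) h.left_ne))]
        field_simp)
      (by norm_num [lowerTriangle]) (by norm_num [lowerTriangle])
    simp only [] at hU' hD'
    rw [hval 1 (by norm_num) (1 / 2) (by norm_num)] at hU'
    rw [hval (1 / 2) (by norm_num) 1 (by norm_num)] at hD'
    norm_num at hU' hD' ⊢
    linear_combination hU' - hD'
  have e7 : LU (3, 3) - LD (3, 3) = LU (5 / 2, 2) - LD (5 / 2, 2) +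
      (log (-I * (1 / 2)) - log (-I * (-1 / 2))) := by
    have hsub := lowerTriangle_subset (c := 2) (d := 3) (c' := 0) (d' := 3) (by norm_num) le_rfl
    have him : ∀ s ∈ Icc (2 : ℝ) 3, ∀ t ∈ Icc (2 : ℝ) 3, 0 ≤ ((γ s - τ t) / w).im := by
      intro s hs t ht
      have hv := h.right_ne
      rw [h.finish s hs]
      rcases le_total (5 / 2) t with h1 | h1
      · rw [hτ, h.leftShift_of_ge h1]
        have : (b + (3 - s) * w - (b + w / 2 * exp ((-(ε * (2 * t - 5)) : ℝ) * I))) / w =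
            ((3 - s : ℝ) : ℂ) - (1 / 2 : ℝ) * exp ((-(ε * (2 * t - 5)) : ℝ) * I) := by
          push_cast
          field_simp
          ring
        rw [this, sub_im, im_ofReal_mul, exp_ofReal_mul_I_im, ofReal_im, Real.sin_neg]
        have := Real.sin_nonneg_of_nonneg_of_le_pi (x := ε * (2 * t - 5)) (by
          apply mul_nonneg h0.le; linarith) (by nlinarith [ht.2])
        linarith
      · rw [hτ, h.leftShift_of_mem ⟨by linarith [ht.1], h1⟩, h.finish t ht]
        have : (b + (3 - s) * w - (b + (3 - t) * w)) / w = ((t - s : ℝ) : ℂ) := by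
          push_cast
          field_simp
          ring
        rw [this, ofReal_im]
    have hval : ∀ s ∈ Icc (2 : ℝ) (5 / 2), ∀ t ∈ Icc (2 : ℝ) (5 / 2),
        (γ s - τ t) / w = t - s := by
      intro s hs t ht
      have hv := h.right_ne
      rw [h.finish s ⟨hs.1, by linarith [hs.2]⟩, hτ, h.leftShift_of_mem ⟨by linarith [ht.1], ht.2⟩,
        h.finish t ⟨ht.1, by linarith [ht.2]⟩]
      field_simp
      ring
    have hmU : ∀ q ∈ lowerTriangle 2 3, q.1 ∈ Icc (2 : ℝ) 3 ∧ q.2 ∈ Icc (2 : ℝ) 3 := fun q hq =>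
      ⟨⟨hq.1.trans hq.2.1, hq.2.2.1⟩, ⟨hq.1, hq.2.1.trans hq.2.2.1⟩⟩
    have hU' := sub_eq_sub_of_exp (x := (3, 3)) (y := (5 / 2, 2)) (c := w / -I)
      (hpre (c := 2) (d := 3) (by norm_num)) (hLU.mono hsub)
      (g := fun q => log (-I * ((γ q.1 - τ q.2) / w)))
      ((continuousOn_const.mul ((hGc.mono fun q hq => hU (hsub hq)).div_const w)).clog
        fun q hq => neg_I_mul_mem_slitPlane (div_ne_zero (hneU q (hsub hq)) h.right_ne)
          (him _ (hmU q hq).1 _ (hmU q hq).2))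
      (fun q hq => by
        have hv := h.right_ne
        have hI := I_ne_zero
        rw [hLUe q (hsub hq), exp_log (mul_ne_zero (neg_ne_zero.2 I_ne_zero)
          (div_ne_zero (hneU q (hsub hq)) h.right_ne))]
        field_simp)
      (by norm_num [lowerTriangle]) (by norm_num [lowerTriangle])
    have hD' := sub_eq_sub_of_exp (x := (3, 3)) (y := (5 / 2, 2)) (c := w / -I)
      (hpre (c := 2) (d := 3) (by norm_num)) (hLD.mono hsub)
      (g := fun q => log (-I * ((γ q.2 - τ q.1) / w)))
      ((continuousOn_const.mul ((hDc.mono hsub).div_const w)).clog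
        fun q hq => neg_I_mul_mem_slitPlane (div_ne_zero (hneD q (hsub hq)) h.right_ne)
          (him _ (hmU q hq).2 _ (hmU q hq).1))
      (fun q hq => by
        have hv := h.right_ne
        have hI := I_ne_zero
        rw [hLDe q (hsub hq), exp_log (mul_ne_zero (neg_ne_zero.2 I_ne_zero)
          (div_ne_zero (hneD q (hsub hq)) h.right_ne))]
        field_simp)
      (by norm_num [lowerTriangle]) (by norm_num [lowerTriangle])
    simp only [] at hU' hD'
    rw [hval (5 / 2) (by norm_num) 2 (by norm_num)] at hU'
    rw [hval 2 (by norm_num) (5 / 2) (by norm_num)] at hD'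
    norm_num at hU' hD' ⊢
    linear_combination hU' - hD'
  -- The half turns around the two ends of the zero set cancel.
  have e8 : log (-I * (1 / 2)) - log (-I * (-1 / 2)) = log (I * (-1 / 2)) - log (I * (1 / 2)) := by
    congr 2 <;> ring
  rw [e1, e2, e3, e4]
  rw [e8] at e7
  linear_combination e6 - e7 + e5

end

/-! ### The jump of the winding integral across an edge -/

theorem log_half_mul_exp {θ : ℝ} (h1 : -Real.pi < θ) (h2 : θ ≤ Real.pi) :
    log (1 / 2 * exp (θ * I)) = log (1 / 2) + θ * I := by
  have h3 : ((1 / 2 : ℝ) : ℂ) = 1 / 2 := by push_cast; rfl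
  have := log_ofReal_mul (r := 1 / 2) (x := exp (θ * I)) (by norm_num) (exp_ne_zero _)
  rw [h3] at this
  rw [this, log_exp (by simpa using h1) (by simpa using h2), ofReal_log (by norm_num), h3]

theorem log_I_mul {z : ℂ} (hz : 0 < z.re) : log (I * z) = log z + Real.pi / 2 * I := by
  have hz0 : z ≠ 0 := by rintro rfl; simp at hz
  have := abs_lt.1 (abs_arg_lt_pi_div_two_iff.2 (Or.inl hz))
  rw [log_mul I_ne_zero hz0, log_I]
  · ring
  · rw [arg_I]
    exact ⟨by linarith [this.1, Real.pi_pos], by linarith [this.2]⟩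

theorem log_neg_I_mul {z : ℂ} (hz : 0 < z.re) : log (-I * z) = log z - Real.pi / 2 * I := by
  have hz0 : z ≠ 0 := by rintro rfl; simp at hz
  have := abs_lt.1 (abs_arg_lt_pi_div_two_iff.2 (Or.inl hz))
  rw [log_mul (neg_ne_zero.2 I_ne_zero) hz0, log_neg_I]
  · ring
  · rw [arg_neg_I]
    exact ⟨by linarith [this.1, Real.pi_pos], by linarith [this.2, Real.pi_pos]⟩

theorem half_mul_exp_re_lt (θ : ℝ) : 0 < (1 - 1 / 2 * exp (θ * I)).re := by
  have h3 : ((1 / 2 : ℝ) : ℂ) = 1 / 2 := by push_cast; rfl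
  rw [sub_re, one_re, ← h3, re_ofReal_mul, exp_ofReal_mul_I_re]
  linarith [Real.cos_le_one θ]

/-- The winding integral of a radial path jumps by `2πi` when the base point crosses the path. -/
theorem RadialPath.logVar_cross {γ : ℝ → ℂ} {a b v w : ℂ} {ε : ℝ} (h : RadialPath γ a b v w)
    (h0 : 0 < ε) (hπ : ε < Real.pi) :
    logVar (fun s => γ s - (a + v / 2 * exp (ε * I))) 0 3 -
      logVar (fun s => γ s - (a + v / 2 * exp (-ε * I))) 0 3 =
    logVar (fun t : ℝ => a + v / 2 * exp ((ε * t : ℝ) * I) - b) (-1) 1 -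
      logVar (fun t : ℝ => a + v / 2 * exp ((ε * t : ℝ) * I) - a) (-1) 1 + 2 * Real.pi * I := by
  set τ : ℝ → ℂ := fun t => a + v / 2 * exp ((ε * t : ℝ) * I) with hτ
  have hv := h.left_ne
  have hvn := norm_pos_iff.2 h.left_ne
  have hI := I_ne_zero
  have hτc : Continuous τ := by fun_prop
  have hτn : ∀ t, ‖τ t - a‖ = ‖v‖ / 2 := fun t => by
    rw [hτ]; dsimp only; rw [add_sub_cancel_left, norm_half_mul_exp]
  have hτ1 : a + v / 2 * exp (ε * I) = τ 1 := by simp [hτ]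
  have hτ2 : a + v / 2 * exp (-ε * I) = τ (-1) := by simp [hτ]
  have hg1 : γ 1 = a + v := by rw [h.start 1 (by norm_num)]; norm_num
  have hg3 : γ 3 = b := by rw [h.finish 3 (by norm_num)]; norm_num
  have hfac : ∀ s ∈ Icc (0 : ℝ) 1, ∀ t : ℝ, γ s - τ t = v * (s - 1 / 2 * exp ((ε * t : ℝ) * I)) := by
    intro s hs t
    rw [h.start s hs, hτ]
    ring
  have him : ∀ s t : ℝ, ((s : ℂ) - 1 / 2 * exp ((ε * t : ℝ) * I)).im =
      - (1 / 2 * Real.sin (ε * t)) := by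
    intro s t
    have h3 : ((1 / 2 : ℝ) : ℂ) = 1 / 2 := by push_cast; rfl
    rw [sub_im, ofReal_im, ← h3, im_ofReal_mul, exp_ofReal_mul_I_im]
    ring
  have hsin := Real.sin_pos_of_pos_of_lt_pi h0 hπ
  have hfne : ∀ s t : ℝ, t = 1 ∨ t = -1 → (s : ℂ) - 1 / 2 * exp ((ε * t : ℝ) * I) ≠ 0 := by
    intro s t ht hz
    have := him s t
    rw [hz] at this
    rcases ht with rfl | rfl <;> simp at this <;> linarith
  have hne : ∀ s ∈ Icc (0 : ℝ) 3, ∀ t, t = 1 ∨ t = -1 → γ s - τ t ≠ 0 := by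
    intro s hs t ht hz
    have hs1 : s < 1 := h.lt_one s hs (by rw [sub_eq_zero.1 hz, hτn]; linarith)
    rw [hfac s ⟨hs.1, hs1.le⟩] at hz
    exact hfne s t ht ((mul_eq_zero.1 hz).resolve_left hv)
  have hsplit : ∀ t, t = 1 ∨ t = -1 → logVar (fun s => γ s - τ t) 0 3 =
      logVar (fun s => γ s - τ t) 0 1 + logVar (fun s => γ s - τ t) 1 3 := fun t ht =>
    (logVar_add (by norm_num) (by norm_num) (h.cont.sub continuousOn_const)
      fun s hs => hne s hs t ht).symm
  -- Only the part of `γ` over `[0, 1]` meets the arc `τ`. The rest obeys the rectangle identity,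
  -- and the radius is computed with explicit logarithms.
  have hfar := logVar_sub_move (γ := γ) (τ := τ) (a := 1) (b := 3) (c := -1) (d := 1)
    (by norm_num) (by norm_num) (h.cont.mono (Icc_subset_Icc_left (by norm_num)))
    hτc.continuousOn (fun s hs t _ heq => by
      have := h.lt_one s ⟨by linarith [hs.1], hs.2⟩ (by rw [heq, hτn]; linarith)
      linarith [hs.1])
  rw [hg3, hg1] at hfar
  have e1 : logVar (fun s => γ s - τ 1) 0 1 =
      log (I * (1 - 1 / 2 * exp (ε * I))) - log (1 / 2 * exp ((ε - Real.pi / 2 : ℝ) * I)) := by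
    have hsp : ∀ s : ℝ, I * ((s : ℂ) - 1 / 2 * exp ((ε * 1 : ℝ) * I)) ∈ slitPlane := fun s =>
      I_mul_mem_slitPlane (hfne s 1 (Or.inl rfl)) (by rw [him, mul_one]; linarith)
    rw [logVar_eq (L := fun s : ℝ => log (v / I) + log (I * ((s : ℂ) - 1 / 2 * exp ((ε * 1 : ℝ) * I))))
      (by norm_num)]
    · have : I * ((0 : ℝ) - 1 / 2 * exp ((ε * 1 : ℝ) * I)) =
          1 / 2 * exp ((ε - Real.pi / 2 : ℝ) * I) := by
        push_cast
        rw [sub_mul, exp_sub, exp_pi_div_two_mul_I]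
        field_simp
        rw [I_sq]
        ring_nf
      rw [this]
      push_cast
      rw [mul_one]
      ring
    · exact continuousOn_const.add
        (ContinuousOn.clog (by fun_prop) fun s _ => hsp s)
    · intro s hs
      rw [exp_add, exp_log (div_ne_zero hv hI), exp_log (slitPlane_ne_zero (hsp s)), hfac s hs]
      field_simp
  have e2 : logVar (fun s => γ s - τ (-1)) 0 1 =
      log (-I * (1 - 1 / 2 * exp ((-ε : ℝ) * I))) -
        log (1 / 2 * exp ((Real.pi / 2 - ε : ℝ) * I)) := by
    have hsp : ∀ s : ℝ, -I * ((s : ℂ) - 1 / 2 * exp ((ε * (-1) : ℝ) * I)) ∈ slitPlane := fun s =>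
      neg_I_mul_mem_slitPlane (hfne s (-1) (Or.inr rfl)) (by
        rw [him, mul_neg_one, Real.sin_neg]; linarith)
    rw [logVar_eq (L := fun s : ℝ => log (v / -I) +
      log (-I * ((s : ℂ) - 1 / 2 * exp ((ε * (-1) : ℝ) * I)))) (by norm_num)]
    · have : -I * ((0 : ℝ) - 1 / 2 * exp ((ε * (-1) : ℝ) * I)) =
          1 / 2 * exp ((Real.pi / 2 - ε : ℝ) * I) := by
        push_cast
        rw [sub_mul, exp_sub, exp_pi_div_two_mul_I, show (ε : ℂ) * -1 * I = -(ε * I) by ring, exp_neg]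
        ring
      rw [this]
      push_cast
      rw [mul_neg_one]
      ring
    · exact continuousOn_const.add
        (ContinuousOn.clog (by fun_prop) fun s _ => hsp s)
    · intro s hs
      rw [exp_add, exp_log (div_ne_zero hv (neg_ne_zero.2 hI)), exp_log (slitPlane_ne_zero (hsp s)),
        hfac s hs]
      field_simp
  have e3 : logVar (fun t => τ t - (a + v)) (-1) 1 =
      log (1 - 1 / 2 * exp (ε * I)) - log (1 - 1 / 2 * exp ((-ε : ℝ) * I)) := by
    have hsp : ∀ t : ℝ, 1 - 1 / 2 * exp ((ε * t : ℝ) * I) ∈ slitPlane := fun t =>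
      mem_slitPlane_iff.2 (Or.inl (half_mul_exp_re_lt _))
    rw [logVar_eq (L := fun t : ℝ => log (-v) + log (1 - 1 / 2 * exp ((ε * t : ℝ) * I)))
      (by norm_num)]
    · push_cast
      rw [mul_one, mul_neg_one]
      ring
    · exact continuousOn_const.add (ContinuousOn.clog (by fun_prop) fun s _ => hsp s)
    · intro t _
      rw [exp_add, exp_log (neg_ne_zero.2 hv), exp_log (slitPlane_ne_zero (hsp t)), hτ]
      ring
  have e4 : logVar (fun t => τ t - a) (-1) 1 = 2 * ε * I := by
    rw [logVar_eq (L := fun t : ℝ => log (v / 2) + (ε * t : ℝ) * I) (by norm_num) (by fun_prop)]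
    · push_cast
      ring
    · intro t _
      rw [exp_add, exp_log (div_ne_zero hv two_ne_zero), hτ]
      ring
  rw [hτ1, hτ2, hsplit 1 (Or.inl rfl), hsplit (-1) (Or.inr rfl), e1, e2, e4]
  rw [e3] at hfar
  -- Besides the terms of `e3`, the radius contributes a difference of `2πi - 2εi`; the part `2εi`
  -- is the variation in `e4`, and the rest is the jump.
  rw [log_I_mul (half_mul_exp_re_lt _), log_neg_I_mul (half_mul_exp_re_lt _),
    log_half_mul_exp (by linarith) (by linarith), log_half_mul_exp (by linarith) (by linarith)]
  change _ = logVar (fun t => τ t - b) (-1) 1 - _ + _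
  generalize logVar (fun t => τ t - b) (-1) 1 = B at hfar ⊢
  push_cast at hfar ⊢
  linear_combination hfar

/-! ### The cycle space of a bipartite graph -/

section CycleSpace
variable {X Y : Type*} [DecidableEq X] [DecidableEq Y]

/-- The boundary map of the bipartite graph with parts `A`, `B` and edge set `S`. -/
noncomputable def boundaryMap (S : Finset (X × Y)) (A : Finset X) (B : Finset Y) :
    (S → ℂ) →ₗ[ℂ] (A → ℂ) × (B → ℂ) :=
  LinearMap.prod
    (LinearMap.pi fun x => ∑ e : S, if e.1.1 = x.1 then LinearMap.proj e else 0)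
    (LinearMap.pi fun y => ∑ e : S, if e.1.2 = y.1 then LinearMap.proj e else 0)

variable {S : Finset (X × Y)} {A : Finset X} {B : Finset Y}

theorem mem_ker_boundaryMap {z : S → ℂ} : z ∈ LinearMap.ker (boundaryMap S A B) ↔
    (∀ x ∈ A, ∑ e : S, (if e.1.1 = x then z e else 0) = 0) ∧
      ∀ y ∈ B, ∑ e : S, (if e.1.2 = y then z e else 0) = 0 := by
  have h1 : ∀ (p : Prop) [Decidable p] (e : S),
      (if p then (LinearMap.proj e : (S → ℂ) →ₗ[ℂ] ℂ) else 0) z = if p then z e else 0 := by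
    intro p _ e
    split_ifs <;> rfl
  simp only [boundaryMap, LinearMap.mem_ker, LinearMap.prod_apply, Function.prod_apply,
    Prod.mk_eq_zero, funext_iff,
    LinearMap.pi_apply, LinearMap.sum_apply, h1, Pi.zero_apply, Subtype.forall]

/-- Coboundaries annihilate cycles: grouping by vertices leaves the vanishing vertex sums of `z`.
All edges are oriented from `X` to `Y`, so `boundaryMap` needs no signs. -/
theorem sum_mul_of_mem_ker (hS : S ⊆ A ×ˢ B) {z : S → ℂ}
    (hz : z ∈ LinearMap.ker (boundaryMap S A B)) (f : X → ℂ) (g : Y → ℂ) :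
    ∑ e : S, (g e.1.2 - f e.1.1) * z e = 0 := by
  rw [mem_ker_boundaryMap] at hz
  have h1 : ∑ e : S, f e.1.1 * z e = 0 := by
    calc ∑ e : S, f e.1.1 * z e
        = ∑ e : S, ∑ x ∈ A, f x * (if e.1.1 = x then z e else 0) := by
          refine Finset.sum_congr rfl fun e _ => ?_
          rw [Finset.sum_eq_single e.1.1]
          · simp
          · intro x _ hx
            simp [hx.symm]
          · exact fun h => absurd (Finset.mem_product.1 (hS e.2)).1 h
      _ = ∑ x ∈ A, f x * ∑ e : S, (if e.1.1 = x then z e else 0) := by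
          rw [Finset.sum_comm]
          simp only [Finset.mul_sum]
      _ = 0 := Finset.sum_eq_zero fun x hx => by rw [hz.1 x hx, mul_zero]
  have h2 : ∑ e : S, g e.1.2 * z e = 0 := by
    calc ∑ e : S, g e.1.2 * z e
        = ∑ e : S, ∑ y ∈ B, g y * (if e.1.2 = y then z e else 0) := by
          refine Finset.sum_congr rfl fun e _ => ?_
          rw [Finset.sum_eq_single e.1.2]
          · simp
          · intro y _ hy
            simp [hy.symm]
          · exact fun h => absurd (Finset.mem_product.1 (hS e.2)).2 h
      _ = ∑ y ∈ B, g y * ∑ e : S, (if e.1.2 = y then z e else 0) := by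
          rw [Finset.sum_comm]
          simp only [Finset.mul_sum]
      _ = 0 := Finset.sum_eq_zero fun y hy => by rw [hz.2 y hy, mul_zero]
  simp only [sub_mul, Finset.sum_sub_distrib, h1, h2, sub_zero]

/-- The cycle space of a bipartite graph has dimension at least `|E| - |V| + 1`. -/
theorem card_lt_finrank_ker_boundaryMap (hS : S ⊆ A ×ˢ B) (hA : A.Nonempty) :
    S.card + 1 ≤ Module.finrank ℂ (LinearMap.ker (boundaryMap S A B)) + A.card + B.card := by
  -- Every edge is counted once in each part, so the boundary lands in the hyperplane where the two
  -- totals agree. This codimension gives the `+ 1`.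
  let φ : (A → ℂ) × (B → ℂ) →ₗ[ℂ] ℂ :=
    (∑ x : A, LinearMap.proj x) ∘ₗ LinearMap.fst ℂ _ _ -
      (∑ y : B, LinearMap.proj y) ∘ₗ LinearMap.snd ℂ _ _
  have hφ : ∀ q, φ q = ∑ x : A, q.1 x - ∑ y : B, q.2 y := fun q => by
    simp [φ]
  have hle : LinearMap.range (boundaryMap S A B) ≤ LinearMap.ker φ := by
    rintro _ ⟨z, rfl⟩
    rw [LinearMap.mem_ker, hφ]
    have h1 : ∀ (p : Prop) [Decidable p] (e : S),
        (if p then (LinearMap.proj e : (S → ℂ) →ₗ[ℂ] ℂ) else 0) z = if p then z e else 0 := by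
      intro p _ e
      split_ifs <;> rfl
    simp only [boundaryMap, LinearMap.prod_apply, Function.prod_apply, LinearMap.pi_apply,
      LinearMap.sum_apply, h1]
    rw [Finset.sum_comm, Finset.sum_comm (s := (Finset.univ : Finset B)), sub_eq_zero]
    refine Finset.sum_congr rfl fun e _ => ?_
    have he := Finset.mem_product.1 (hS e.2)
    rw [Finset.sum_eq_single ⟨e.1.1, he.1⟩, Finset.sum_eq_single ⟨e.1.2, he.2⟩]
    · simp
    · intro y _ hy
      exact if_neg fun h => hy (Subtype.ext h.symm)
    · exact fun h => absurd (Finset.mem_univ _) h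
    · intro x _ hx
      exact if_neg fun h => hx (Subtype.ext h.symm)
    · exact fun h => absurd (Finset.mem_univ _) h
  have hsurj : LinearMap.range φ = ⊤ := by
    obtain ⟨x, hx⟩ := hA
    rw [LinearMap.range_eq_top]
    intro c
    refine ⟨(Pi.single ⟨x, hx⟩ c, 0), ?_⟩
    rw [hφ]
    simp
  have e1 := LinearMap.finrank_range_add_finrank_ker (boundaryMap S A B)
  have e2 := LinearMap.finrank_range_add_finrank_ker φ
  have e3 := Submodule.finrank_mono hle
  rw [hsurj, finrank_top, Module.finrank_self, Module.finrank_prod, Module.finrank_pi,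
    Module.finrank_pi, Fintype.card_coe, Fintype.card_coe] at e2
  rw [Module.finrank_pi, Fintype.card_coe] at e1
  omega

end CycleSpace

/-! ### Counting sides of edges -/

/-- If the sides of the edges of a bipartite graph carry functionals on a space of functions on
the edges such that crossing an edge detects its coefficient and each value is shared by
consecutive edges of a face, then there are at most `|E| / 2 - 1` independent functions. -/
theorem four_mul_finrank_add_one_le {X Y : Type*} {S : Finset (X × Y)}
    (hne : S.Nonempty) {Z : Submodule ℂ (S → ℂ)} {L R : S → Module.Dual ℂ Z} {c : ℂ} (hc : c ≠ 0)
    (hL : ∀ e : S, ∃ f : S, f.1.2 = e.1.2 ∧ f.1.1 ≠ e.1.1 ∧ L e = R f)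
    (hR : ∀ e : S, ∃ f : S, f.1.1 = e.1.1 ∧ f.1.2 ≠ e.1.2 ∧ R e = L f)
    (hcross : ∀ (e : S) (z : Z), L e z - R e z = c * z.1 e) :
    4 * (Module.finrank ℂ Z + 1) ≤ 2 * S.card := by
  classical
  let V : S × Bool → Module.Dual ℂ Z := fun q => if q.2 then L q.1 else R q.1
  let T : Finset (Module.Dual ℂ Z) := Finset.univ.image V
  have hLT : ∀ e, L e ∈ T := fun e => Finset.mem_image.2 ⟨(e, true), Finset.mem_univ _, rfl⟩
  have hRT : ∀ e, R e ∈ T := fun e => Finset.mem_image.2 ⟨(e, false), Finset.mem_univ _, rfl⟩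
  have hfib : ∀ v ∈ T, 4 ≤ (Finset.univ.filter fun q => V q = v).card := by
    -- Four consecutive sides along a face, alternately left and right. The turns alternate between
    -- the parts, so `e` and `g` differ in one end and `f` and `h` in the other. The walk need not
    -- close up after four sides.
    have key : ∀ e f g h : S, f.1.1 ≠ e.1.1 → g.1.1 = f.1.1 → g.1.2 ≠ f.1.2 → h.1.2 = g.1.2 →
        ∀ b : Bool, 4 ≤ ({(e, b), (f, !b), (g, b), (h, !b)} : Finset (S × Bool)).card := by
      intro e f g h h1 h2 h3 h4 b
      have n1 : e ≠ g := fun hh => h1 (by rw [hh, h2])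
      have n2 : f ≠ h := fun hh => h3 (by rw [hh, h4])
      rw [Finset.card_insert_of_notMem, Finset.card_insert_of_notMem,
        Finset.card_insert_of_notMem, Finset.card_singleton]
      all_goals cases b <;> simp [n1, n2]
    have key' : ∀ e f g h : S, f.1.2 ≠ e.1.2 → g.1.2 = f.1.2 → g.1.1 ≠ f.1.1 → h.1.1 = g.1.1 →
        ∀ b : Bool, 4 ≤ ({(e, b), (f, !b), (g, b), (h, !b)} : Finset (S × Bool)).card := by
      intro e f g h h1 h2 h3 h4 b
      have n1 : e ≠ g := fun hh => h1 (by rw [hh, h2])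
      have n2 : f ≠ h := fun hh => h3 (by rw [hh, h4])
      rw [Finset.card_insert_of_notMem, Finset.card_insert_of_notMem,
        Finset.card_insert_of_notMem, Finset.card_singleton]
      all_goals cases b <;> simp [n1, n2]
    intro v hv
    obtain ⟨⟨e, b⟩, -, rfl⟩ := Finset.mem_image.1 hv
    cases b
    · obtain ⟨f, f1, f2, f3⟩ := hR e
      obtain ⟨g, g1, g2, g3⟩ := hL f
      obtain ⟨h, h1, h2, h3⟩ := hR g
      refine (key' e f g h f2 g1 g2 h1 false).trans (Finset.card_le_card fun q hq => ?_)
      simp only [Bool.not_false, Finset.mem_insert, Finset.mem_singleton] at hq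
      rw [Finset.mem_filter]
      refine ⟨Finset.mem_univ _, ?_⟩
      rcases hq with rfl | rfl | rfl | rfl <;> simp [V, ← f3, ← g3, ← h3]
    · obtain ⟨f, f1, f2, f3⟩ := hL e
      obtain ⟨g, g1, g2, g3⟩ := hR f
      obtain ⟨h, h1, h2, h3⟩ := hL g
      refine (key e f g h f2 g1 g2 h1 true).trans (Finset.card_le_card fun q hq => ?_)
      simp only [Bool.not_true, Finset.mem_insert, Finset.mem_singleton] at hq
      rw [Finset.mem_filter]
      refine ⟨Finset.mem_univ _, ?_⟩
      rcases hq with rfl | rfl | rfl | rfl <;> simp [V, ← f3, ← g3, ← h3]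
  have hcard : T.card * 4 ≤ 2 * S.card := by
    have h1 := Finset.card_nsmul_le_sum T _ 4 hfib
    rw [← Finset.card_eq_sum_card_image V Finset.univ, Finset.card_univ, Fintype.card_prod,
      Fintype.card_coe, Fintype.card_bool, smul_eq_mul] at h1
    omega
  obtain ⟨e₀, he₀⟩ := hne
  set v₀ := L ⟨e₀, he₀⟩ with hv₀
  have hrank : Module.finrank ℂ Z ≤ (T.erase v₀).card := by
    -- If all functionals agree at `z`, then crossing `e` gives `c * z e = 0`. Hence already the
    -- differences to `v₀` separate `Z`, which saves one dimension.
    let ψ : Z →ₗ[ℂ] (T.erase v₀ → ℂ) := LinearMap.pi fun v => v.1 - v₀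
    have hinj : Function.Injective ψ := by
      rw [← LinearMap.ker_eq_bot, LinearMap.ker_eq_bot']
      intro z hz
      have hall : ∀ v ∈ T, v z = v₀ z := by
        intro v hv
        by_cases hvv : v = v₀
        · rw [hvv]
        · have := congrFun hz ⟨v, Finset.mem_erase.2 ⟨hvv, hv⟩⟩
          simpa [ψ, sub_eq_zero] using this
      ext e
      have := hcross e z
      rw [hall _ (hLT e), hall _ (hRT e), sub_self] at this
      simpa [hc] using this.symm
    have := LinearMap.finrank_le_finrank_of_injective hinj
    rwa [Module.finrank_pi, Fintype.card_coe] at this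
  rw [Finset.card_erase_of_mem (hLT _)] at hrank
  have : 0 < T.card := Finset.card_pos.2 ⟨_, hLT ⟨e₀, he₀⟩⟩
  omega

/-! ### Directions of edges around a vertex -/

/-- In a finite family of distinct directions with at least two members, every direction has a
next one in clockwise order. -/
theorem exists_next_direction {ι : Type*} {T : Finset ι} {u : ι → ℂ} {r : ℝ} (hr : 0 < r)
    (hu : ∀ k ∈ T, ‖u k‖ = r) (hinj : InjOn u T) {i : ι} (hi : i ∈ T)
    (h2 : ∃ j ∈ T, j ≠ i) :
    ∃ j ∈ T, j ≠ i ∧ ∃ ω : ℝ, 0 < ω ∧ ω < 2 * Real.pi ∧ u j = u i * exp ((-ω : ℝ) * I) ∧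
      ∀ k ∈ T, ∀ s : ℝ, 0 < s → s < ω → u k ≠ u i * exp ((-s : ℝ) * I) := by
  classical
  have hui : u i ≠ 0 := norm_pos_iff.1 ((hu i hi).symm ▸ hr)
  have hex : ∀ k ∈ T.erase i, ∃ ω : ℝ, 0 < ω ∧ ω < 2 * Real.pi ∧
      u k = u i * exp ((-ω : ℝ) * I) := by
    intro k hk
    obtain ⟨hki, hkT⟩ := Finset.mem_erase.1 hk
    have hn : ‖u k / u i‖ = 1 := by
      rw [norm_div, hu k hkT, hu i hi, div_self hr.ne']
    have harg : u k = u i * exp (arg (u k / u i) * I) := by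
      have := norm_mul_exp_arg_mul_I (u k / u i)
      rw [hn, ofReal_one, one_mul] at this
      rw [this, mul_div_cancel₀ _ hui]
    have hne : arg (u k / u i) ≠ 0 := by
      intro h0
      rw [h0] at harg
      exact hki (hinj hkT hi (by simpa using harg))
    rcases hne.lt_or_gt with h | h
    · refine ⟨-arg (u k / u i), by linarith, ?_, by simpa using harg⟩
      linarith [neg_pi_lt_arg (u k / u i), Real.pi_pos]
    · refine ⟨2 * Real.pi - arg (u k / u i), ?_, by linarith, ?_⟩
      · linarith [arg_le_pi (u k / u i), Real.pi_pos]
      · have : ((-(2 * Real.pi - arg (u k / u i)) : ℝ) : ℂ) * I =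
            arg (u k / u i) * I - 2 * Real.pi * I := by
          push_cast
          ring
        rw [this, exp_sub, exp_two_pi_mul_I, div_one]
        exact harg
  choose! ω hω0 hω2 hωu using hex
  obtain ⟨j₀, hj₀, hj₀i⟩ := h2
  -- With the smallest clockwise angle, no member of the family lies strictly between `i` and `j`.
  obtain ⟨j, hj, hmin⟩ := Finset.exists_min_image (T.erase i) ω
    ⟨j₀, Finset.mem_erase.2 ⟨hj₀i, hj₀⟩⟩
  obtain ⟨hji, hjT⟩ := Finset.mem_erase.1 hj
  have huniq : ∀ s s' : ℝ, 0 ≤ s → s < 2 * Real.pi → 0 ≤ s' → s' < 2 * Real.pi →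
      exp ((-s : ℝ) * I) = exp ((-s' : ℝ) * I) → s = s' := by
    intro s s' h1 h2 h3 h4 he
    obtain ⟨n, hn⟩ := exp_eq_exp_iff_exists_int.1 he
    have hn' : -s = -s' + n * (2 * Real.pi) := by
      have := congrArg Complex.im hn
      simpa using this
    have hπ := Real.two_pi_pos
    have a1 : (n : ℝ) < 1 := by
      by_contra hcon
      nlinarith
    have a2 : (-1 : ℝ) < n := by
      by_contra hcon
      nlinarith
    have : n = 0 := by
      have b1 : n < 1 := by exact_mod_cast a1
      have b2 : -1 < n := by exact_mod_cast a2
      omega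
    rw [this] at hn'
    simp at hn'
    exact hn'
  refine ⟨j, hjT, hji, ω j, hω0 j hj, hω2 j hj, hωu j hj, fun k hk s hs hsω heq => ?_⟩
  by_cases hki : k = i
  · rw [hki] at heq
    have h1 : exp ((-s : ℝ) * I) = exp ((-0 : ℝ) * I) := by
      apply mul_left_cancel₀ hui
      rw [← heq]
      simp
    linarith [huniq s 0 hs.le (hsω.trans (hω2 j hj)) le_rfl Real.two_pi_pos h1]
  · have hk' := Finset.mem_erase.2 ⟨hki, hk⟩
    have h1 := mul_left_cancel₀ hui (heq.symm.trans (hωu k hk'))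
    have := huniq s (ω k) hs.le (hsω.trans (hω2 j hj)) (hω0 k hk').le (hω2 k hk') h1
    linarith [hmin k hk']

/-- Directions in a finite family stay different from all others under small rotations. -/
theorem exists_rotation_bound {ι : Type*} (T : Finset ι) (u : ι → ℂ) (P : ι → ι → Prop)
    (h : ∀ i ∈ T, ∀ j ∈ T, P i j → u i ≠ u j) :
    ∃ ε : ℝ, 0 < ε ∧ ε < Real.pi ∧ ∀ i ∈ T, ∀ j ∈ T, P i j → ∀ s : ℝ, |s| ≤ ε →
      u j ≠ u i * exp (s * I) := by
  have hev : ∀ᶠ s : ℝ in nhds 0, ∀ i ∈ T, ∀ j ∈ T, P i j → u j ≠ u i * exp (s * I) := by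
    rw [Filter.eventually_all_finset]
    intro i hi
    rw [Filter.eventually_all_finset]
    intro j hj
    by_cases hP : P i j
    · have hc : Continuous fun s : ℝ => u i * exp (s * I) := by fun_prop
      have := hc.continuousAt.eventually_ne (x := 0) (y := u j) (by simpa using h i hi j hj hP)
      filter_upwards [this] with s hs _ using hs.symm
    · exact Filter.Eventually.of_forall fun s h => absurd h hP
  obtain ⟨δ, hδ, hball⟩ := Metric.eventually_nhds_iff.1 hev
  have hπ := Real.pi_pos
  refine ⟨min (δ / 2) (Real.pi / 2), lt_min (by linarith) (by linarith),
    (min_le_right _ _).trans_lt (by linarith), fun i hi j hj hP s hs => ?_⟩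
  refine hball ?_ i hi j hj hP
  rw [Real.dist_eq, sub_zero]
  exact (hs.trans (min_le_left _ _)).trans_lt (by linarith)

/-! ### Radial drawings and their winding functionals -/

/-- A drawing of a bipartite graph with edge set `S` whose edges are radial near the vertices. -/
structure RadialDrawing {X Y : Type*} (S : Finset (X × Y)) where
  px : X → ℂ
  py : Y → ℂ
  v : X × Y → ℂ
  w : X × Y → ℂ
  γ : X × Y → ℝ → ℂ
  r : ℝ
  r_pos : 0 < r
  norm_v : ∀ e ∈ S, ‖v e‖ = r
  norm_w : ∀ e ∈ S, ‖w e‖ = r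
  radial : ∀ e ∈ S, RadialPath (γ e) (px e.1) (py e.2) (v e) (w e)
  disjoint : ∀ e ∈ S, ∀ f ∈ S, e ≠ f → ∀ s ∈ Icc (0 : ℝ) 3, ∀ t ∈ Icc (0 : ℝ) 3,
    γ e s = γ f t → (s = 0 ∧ t = 0) ∨ (s = 3 ∧ t = 3)
  away_left : ∀ e ∈ S, ∀ f ∈ S, f.1 ≠ e.1 → ∀ s ∈ Icc (0 : ℝ) 3, r ≤ ‖γ f s - px e.1‖
  away_right : ∀ e ∈ S, ∀ f ∈ S, f.2 ≠ e.2 → ∀ s ∈ Icc (0 : ℝ) 3, r ≤ ‖γ f s - py e.2‖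

namespace RadialDrawing
variable {X Y : Type*} {S : Finset (X × Y)} (D : RadialDrawing S)

theorem v_ne {e f : X × Y} (he : e ∈ S) (hf : f ∈ S) (hef : e ≠ f) (h1 : e.1 = f.1) :
    D.v e ≠ D.v f := by
  intro hv
  have := D.disjoint e he f hf hef (1 / 2) (by norm_num) (1 / 2) (by norm_num) (by
    rw [(D.radial e he).half, (D.radial f hf).half, hv, h1])
  norm_num at this

theorem w_ne {e f : X × Y} (he : e ∈ S) (hf : f ∈ S) (hef : e ≠ f) (h1 : e.2 = f.2) :
    D.w e ≠ D.w f := by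
  intro hv
  have := D.disjoint e he f hf hef (5 / 2) (by norm_num) (5 / 2) (by norm_num) (by
    rw [(D.radial e he).five_halves, (D.radial f hf).five_halves, hv, h1])
  norm_num at this

/-- An edge through a point of the circle of radius `r / 2` around a left vertex is incident to
that vertex and points in the direction of the point. -/
theorem of_mem_circle_left {e f : X × Y} (he : e ∈ S) (hf : f ∈ S) {s θ : ℝ}
    (hs : s ∈ Icc (0 : ℝ) 3) (h : D.γ f s = D.px e.1 + D.v e / 2 * exp (θ * I)) :
    f.1 = e.1 ∧ D.v f = D.v e * exp (θ * I) := by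
  have hr := D.r_pos
  have hn : ‖D.γ f s - D.px e.1‖ = D.r / 2 := by
    rw [h, add_sub_cancel_left, norm_half_mul_exp, D.norm_v e he]
  have h1 : f.1 = e.1 := by
    by_contra hne
    have := D.away_left e he f hf hne s hs
    linarith
  refine ⟨h1, ?_⟩
  have hs1 := (D.radial f hf).lt_one s hs (by rw [h1, hn, D.norm_v f hf]; linarith)
  rw [(D.radial f hf).start s ⟨hs.1, hs1.le⟩, h1] at h hn
  rw [add_sub_cancel_left, norm_mul, norm_real, Real.norm_of_nonneg hs.1, D.norm_v f hf] at hn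
  have hs2 : s = 1 / 2 := by
    apply mul_right_cancel₀ hr.ne'
    linarith
  rw [hs2] at h
  push_cast at h
  linear_combination 2 * h

/-- An edge through a point of the circle of radius `r / 2` around a right vertex is incident to
that vertex and points in the direction of the point. -/
theorem of_mem_circle_right {e f : X × Y} (he : e ∈ S) (hf : f ∈ S) {s θ : ℝ}
    (hs : s ∈ Icc (0 : ℝ) 3) (h : D.γ f s = D.py e.2 + D.w e / 2 * exp (θ * I)) :
    f.2 = e.2 ∧ D.w f = D.w e * exp (θ * I) := by
  have hr := D.r_pos
  have hn : ‖D.γ f s - D.py e.2‖ = D.r / 2 := by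
    rw [h, add_sub_cancel_left, norm_half_mul_exp, D.norm_w e he]
  have h1 : f.2 = e.2 := by
    by_contra hne
    have := D.away_right e he f hf hne s hs
    linarith
  refine ⟨h1, ?_⟩
  have hs1 := (D.radial f hf).two_lt s hs (by rw [h1, hn, D.norm_w f hf]; linarith)
  rw [(D.radial f hf).finish s ⟨hs1.le, hs.2⟩, h1] at h hn
  have h3 : ((3 - s : ℝ) : ℂ) = 3 - s := by push_cast; rfl
  rw [add_sub_cancel_left, norm_mul, ← h3, norm_real, Real.norm_of_nonneg (by linarith [hs.2]),
    D.norm_w f hf] at hn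
  have hs2 : s = 5 / 2 := by
    apply mul_right_cancel₀ hr.ne'
    linarith
  rw [hs2] at h
  push_cast at h
  linear_combination 2 * h

theorem left_apply_zero {e : X × Y} (he : e ∈ S) : D.γ e 0 = D.px e.1 := by
  rw [(D.radial e he).start 0 (by norm_num)]
  norm_num

theorem right_apply_three {e : X × Y} (he : e ∈ S) : D.γ e 3 = D.py e.2 := by
  rw [(D.radial e he).finish 3 (by norm_num)]
  norm_num

/-- An angle which is smaller than all angles between different edges at a vertex. -/
theorem exists_angle_bound : ∃ ε : ℝ, 0 < ε ∧ ε < Real.pi ∧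
    ∀ e ∈ S, ∀ f ∈ S, e ≠ f → ∀ θ : ℝ, |θ| ≤ ε →
      (e.1 = f.1 → D.v f ≠ D.v e * exp (θ * I)) ∧
      (e.2 = f.2 → D.w f ≠ D.w e * exp (θ * I)) := by
  obtain ⟨ε₁, h1, h1', h1''⟩ := exists_rotation_bound S D.v (fun e f => e ≠ f ∧ e.1 = f.1)
    fun e he f hf hef => D.v_ne he hf hef.1 hef.2
  obtain ⟨ε₂, h2, h2', h2''⟩ := exists_rotation_bound S D.w (fun e f => e ≠ f ∧ e.2 = f.2)
    fun e he f hf hef => D.w_ne he hf hef.1 hef.2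
  exact ⟨min ε₁ ε₂, lt_min h1 h2, (min_le_left _ _).trans_lt h1', fun e he f hf hef θ hθ =>
    ⟨fun h => h1'' e he f hf ⟨hef, h⟩ θ (hθ.trans (min_le_left _ _)),
      fun h => h2'' e he f hf ⟨hef, h⟩ θ (hθ.trans (min_le_right _ _))⟩⟩

/-- An edge different from `e` does not meet the left shift of `e`, nor that of its reverse. -/
theorem ne_leftShift {ε : ℝ} (h0 : 0 < ε) (hε : ∀ e ∈ S, ∀ f ∈ S, e ≠ f → ∀ θ : ℝ, |θ| ≤ ε →
      (e.1 = f.1 → D.v f ≠ D.v e * exp (θ * I)) ∧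
      (e.2 = f.2 → D.w f ≠ D.w e * exp (θ * I))) {e f : X × Y} (he : e ∈ S) (hf : f ∈ S)
    (hef : e ≠ f) {s t : ℝ} (hs : s ∈ Icc (0 : ℝ) 3) (ht : t ∈ Icc (0 : ℝ) 3) :
    D.γ f s ≠ leftShift (D.γ e) (D.px e.1) (D.py e.2) (D.v e) (D.w e) ε t ∧
    D.γ f s ≠ leftShift (fun t => D.γ e (3 - t)) (D.py e.2) (D.px e.1) (D.w e) (D.v e) ε t := by
  have habs1 : t ≤ 1 / 2 → |ε * (1 - 2 * t)| ≤ ε := fun h => by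
    rw [abs_of_nonneg (mul_nonneg h0.le (by linarith))]
    nlinarith [ht.1]
  have habs2 : 5 / 2 ≤ t → |(-(ε * (2 * t - 5)))| ≤ ε := fun h => by
    rw [abs_neg, abs_of_nonneg (mul_nonneg h0.le (by linarith))]
    nlinarith [ht.2]
  rcases le_total t (1 / 2) with h1 | h1
  · rw [leftShift_of_le h1, leftShift_of_le h1]
    refine ⟨fun h => ?_, fun h => ?_⟩
    · obtain ⟨a1, a2⟩ := D.of_mem_circle_left he hf hs h
      exact (hε e he f hf hef _ (habs1 h1)).1 a1.symm a2
    · obtain ⟨a1, a2⟩ := D.of_mem_circle_right he hf hs h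
      exact (hε e he f hf hef _ (habs1 h1)).2 a1.symm a2
  rcases le_total t (5 / 2) with h2 | h2
  · rw [(D.radial e he).leftShift_of_mem ⟨h1, h2⟩, (D.radial e he).reverse.leftShift_of_mem ⟨h1, h2⟩]
    refine ⟨fun h => ?_, fun h => ?_⟩
    · have := D.disjoint e he f hf hef t ht s hs h.symm
      rcases this with h | h <;> linarith [h.1]
    · have := D.disjoint e he f hf hef (3 - t) ⟨by linarith, by linarith⟩ s hs h.symm
      rcases this with h | h <;> linarith [h.1]
  · rw [(D.radial e he).leftShift_of_ge h2, (D.radial e he).reverse.leftShift_of_ge h2]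
    refine ⟨fun h => ?_, fun h => ?_⟩
    · obtain ⟨a1, a2⟩ := D.of_mem_circle_right he hf hs h
      exact (hε e he f hf hef _ (habs2 h2)).2 a1.symm a2
    · obtain ⟨a1, a2⟩ := D.of_mem_circle_left he hf hs h
      exact (hε e he f hf hef _ (habs2 h2)).1 a1.symm a2

variable [DecidableEq X] [DecidableEq Y] (A : Finset X) (B : Finset Y)

/-- The functional on cycles given by the winding integral around the point `p`. -/
noncomputable def winding (p : ℂ) : Module.Dual ℂ (LinearMap.ker (boundaryMap S A B)) :=
  (∑ e : S, logVar (fun s => D.γ e s - p) 0 3 • (LinearMap.proj e : (S → ℂ) →ₗ[ℂ] ℂ)) ∘ₗ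
    Submodule.subtype _

variable {A B}

/-- The terms `g - f` form a coboundary and vanish on cycles; `δ` records the edges crossed between
`p` and `q`. -/
theorem winding_sub (hS : S ⊆ A ×ˢ B) {p q : ℂ} (f : X → ℂ) (g : Y → ℂ) (δ : S → ℂ)
    (h : ∀ e : S, logVar (fun s => D.γ e s - q) 0 3 - logVar (fun s => D.γ e s - p) 0 3 =
      g e.1.2 - f e.1.1 + δ e) (z : LinearMap.ker (boundaryMap S A B)) :
    D.winding A B q z - D.winding A B p z = ∑ e : S, δ e * z.1 e := by
  have hval : ∀ p, D.winding A B p z =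
      ∑ e : S, logVar (fun s => D.γ e s - p) 0 3 * z.1 e := fun p => by
    simp [winding]
  rw [hval, hval, ← Finset.sum_sub_distrib]
  have h0 := sum_mul_of_mem_ker hS z.2 f g
  calc _ = ∑ e : S, ((g e.1.2 - f e.1.1) * z.1 e + δ e * z.1 e) := by
        refine Finset.sum_congr rfl fun e _ => ?_
        rw [← sub_mul, h e]
        ring
    _ = _ := by rw [Finset.sum_add_distrib, h0, zero_add]

/-- The winding functional does not change along a path disjoint from the drawing. -/
theorem winding_eq_of_path (hS : S ⊆ A ×ˢ B) {τ : ℝ → ℂ} (hτ : Continuous τ)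
    (h : ∀ e ∈ S, ∀ s ∈ Icc (0 : ℝ) 3, ∀ t ∈ Icc (0 : ℝ) 1, D.γ e s ≠ τ t) :
    D.winding A B (τ 0) = D.winding A B (τ 1) := by
  ext z
  have := D.winding_sub hS (p := τ 0) (q := τ 1) (fun x => logVar (fun t => τ t - D.px x) 0 1)
    (fun y => logVar (fun t => τ t - D.py y) 0 1) 0 (fun e => by
      rw [logVar_sub_move (by norm_num) (by norm_num) (D.radial e e.2).cont hτ.continuousOn
        (h e e.2), D.left_apply_zero e.2, D.right_apply_three e.2]
      simp) z
  simp only [Pi.zero_apply, zero_mul, Finset.sum_const_zero] at this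
  exact (sub_eq_zero.1 this).symm

/-- The number of edges of a bipartite graph with minimum degree at least two that has a radial
drawing. -/
theorem card_add_four_le (D : RadialDrawing S) (hS : S ⊆ A ×ˢ B) (hne : S.Nonempty)
    (hdx : ∀ e ∈ S, ∃ f ∈ S, f.1 = e.1 ∧ f ≠ e) (hdy : ∀ e ∈ S, ∃ f ∈ S, f.2 = e.2 ∧ f ≠ e) :
    S.card + 4 ≤ 2 * (A.card + B.card) := by
  obtain ⟨ε, h0, hπ, hε⟩ := D.exists_angle_bound
  have hr := D.r_pos
  -- Points beside `e`: `L` and `R` near its end in `X`, `L'` and `R'` near its end in `Y`. The edge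
  -- leaves the first end and arrives at the second, so the sign of the angle is reversed there.
  let L : S → ℂ := fun e => D.px e.1.1 + D.v e / 2 * exp (ε * I)
  let L' : S → ℂ := fun e => D.py e.1.2 + D.w e / 2 * exp (-ε * I)
  let R : S → ℂ := fun e => D.px e.1.1 + D.v e / 2 * exp (-ε * I)
  let R' : S → ℂ := fun e => D.py e.1.2 + D.w e / 2 * exp (ε * I)
  have s0 : ∀ (γ : ℝ → ℂ) (a b v w : ℂ), leftShift γ a b v w ε 0 = a + v / 2 * exp (ε * I) := by
    intro γ a b v w
    rw [leftShift_of_le (by norm_num)]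
    norm_num
  have s3 : ∀ {γ : ℝ → ℂ} {a b v w : ℂ}, RadialPath γ a b v w →
      leftShift γ a b v w ε 3 = b + w / 2 * exp (-ε * I) := by
    intro γ a b v w h
    rw [h.leftShift_of_ge (by norm_num)]
    norm_num
  have hLL : ∀ e : S, D.winding A B (L e) = D.winding A B (L' e) := by
    intro e
    have hrad := D.radial e e.2
    set τ := leftShift (D.γ e) (D.px e.1.1) (D.py e.1.2) (D.v e) (D.w e) ε with hτ
    ext z
    have := D.winding_sub hS (p := τ 0) (q := τ 3) (fun x => logVar (fun t => τ t - D.px x) 0 3)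
      (fun y => logVar (fun t => τ t - D.py y) 0 3) 0 (fun f => by
        rw [Pi.zero_apply, add_zero]
        -- The shift follows `e` itself, so for `f = e` the disjointness argument is unavailable and
        -- `logVar_leftShift` takes its place.
        by_cases hfe : f = e
        · rw [hfe]
          exact hrad.logVar_leftShift h0 hπ
        · rw [logVar_sub_move (by norm_num) (by norm_num) (D.radial f f.2).cont
            hrad.leftShift_continuousOn (fun s hs t ht => (D.ne_leftShift h0 hε e.2 f.2
              (fun h => hfe (Subtype.ext h.symm)) hs ht).1),
            D.left_apply_zero f.2, D.right_apply_three f.2]) z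
    simp only [Pi.zero_apply, zero_mul, Finset.sum_const_zero] at this
    rw [hτ, s0, s3 hrad] at this
    exact (sub_eq_zero.1 this).symm
  have hRR : ∀ e : S, D.winding A B (R e) = D.winding A B (R' e) := by
    intro e
    have hrad := (D.radial e e.2).reverse
    -- The right side of `e` is the left side of the reversed edge.
    set τ := leftShift (fun t => D.γ e (3 - t)) (D.py e.1.2) (D.px e.1.1) (D.w e) (D.v e) ε with hτ
    have hrev : ∀ p : ℂ, (∀ s ∈ Icc (0 : ℝ) 3, D.γ e (3 - s) ≠ p) →
        logVar (fun s => D.γ e (3 - s) - p) 0 3 = - logVar (fun s => D.γ e s - p) 0 3 := by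
      intro p hp
      refine logVar_reverse (by norm_num) ((D.radial e e.2).cont.sub continuousOn_const)
        fun s hs hz => hp (3 - s) ⟨by linarith [hs.2], by linarith [hs.1]⟩ ?_
      rw [sub_sub_cancel]
      exact sub_eq_zero.1 hz
    ext z
    have := D.winding_sub hS (p := τ 0) (q := τ 3) (fun x => logVar (fun t => τ t - D.px x) 0 3)
      (fun y => logVar (fun t => τ t - D.py y) 0 3) 0 (fun f => by
        rw [Pi.zero_apply, add_zero]
        by_cases hfe : f = e
        · rw [hfe]
          have h1 := hrad.logVar_leftShift h0 hπ
          rw [hrev _ fun s hs h => by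
            have := hrad.eq_of_eq_leftShift h0 hπ hs (t := 3) (by norm_num) h
            linarith [this.2.2],
            hrev _ fun s hs h => by
            have := hrad.eq_of_eq_leftShift h0 hπ hs (t := 0) (by norm_num) h
            linarith [this.2.1]] at h1
          linear_combination -h1
        · rw [logVar_sub_move (by norm_num) (by norm_num) (D.radial f f.2).cont
            hrad.leftShift_continuousOn (fun s hs t ht => (D.ne_leftShift h0 hε e.2 f.2
              (fun h => hfe (Subtype.ext h.symm)) hs ht).2),
            D.left_apply_zero f.2, D.right_apply_three f.2]) z
    simp only [Pi.zero_apply, zero_mul, Finset.sum_const_zero] at this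
    rw [hτ, s0, s3 hrad] at this
    exact sub_eq_zero.1 this
  have hcross : ∀ (e : S) (z : LinearMap.ker (boundaryMap S A B)),
      D.winding A B (L e) z - D.winding A B (R e) z = 2 * Real.pi * I * z.1 e := by
    intro e z
    have hrad := D.radial e e.2
    let τ : ℝ → ℂ := fun t => D.px e.1.1 + D.v e / 2 * exp ((ε * t : ℝ) * I)
    have hτc : Continuous τ := by fun_prop
    have hτ1 : L e = τ 1 := by simp [L, τ]
    have hτ2 : R e = τ (-1) := by simp [R, τ]
    rw [D.winding_sub hS (fun x => logVar (fun t => τ t - D.px x) (-1) 1)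
      (fun y => logVar (fun t => τ t - D.py y) (-1) 1) (Pi.single e (2 * Real.pi * I)) (fun f => ?_)]
    · rw [Finset.sum_eq_single e]
      · simp
      · intro f _ hf
        simp [hf]
      · exact fun h => absurd (Finset.mem_univ _) h
    · by_cases hfe : f = e
      · rw [hfe, Pi.single_eq_same]
        exact hrad.logVar_cross h0 hπ
      · rw [Pi.single_eq_of_ne hfe, add_zero, hτ1, hτ2,
          logVar_sub_move (by norm_num) (by norm_num) (D.radial f f.2).cont
            hτc.continuousOn, D.left_apply_zero f.2, D.right_apply_three f.2]
        intro s hs t ht heq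
        obtain ⟨a1, a2⟩ := D.of_mem_circle_left e.2 f.2 hs heq
        refine (hε e e.2 f f.2 (fun h => hfe (Subtype.ext h.symm)) _ ?_).1 a1.symm a2
        rw [abs_mul, abs_of_pos h0]
        have := abs_le.2 ⟨ht.1, ht.2⟩
        nlinarith
  -- The turn from angle `ε` to `ω - ε` stays strictly between the two edges, even if `ω < 2 * ε`
  -- and it runs backwards.
  have hturn : ∀ {ω t : ℝ}, ε < ω → t ∈ Icc (0 : ℝ) 1 →
      0 < ε + t * (ω - 2 * ε) ∧ ε + t * (ω - 2 * ε) < ω := by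
    intro ω t hω ht
    rcases le_total (2 * ε) ω with h | h
    · have h1 := mul_nonneg ht.1 (sub_nonneg.2 h)
      have h2 := mul_nonneg (sub_nonneg.2 ht.2) (sub_nonneg.2 h)
      exact ⟨by linarith, by linarith⟩
    · have h1 := mul_nonneg ht.1 (sub_nonneg.2 h)
      have h2 := mul_nonneg (sub_nonneg.2 ht.2) (sub_nonneg.2 h)
      exact ⟨by linarith, by linarith⟩
  have hL : ∀ e : S, ∃ f : S, f.1.2 = e.1.2 ∧ f.1.1 ≠ e.1.1 ∧
      D.winding A B (L e) = D.winding A B (R f) := by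
    intro e
    obtain ⟨g, hg, hg1, hg2⟩ := hdy e e.2
    -- At the end in `Y` the left side of `e` is its clockwise side. Turning clockwise leads to the
    -- counterclockwise side of the next edge `f`, which is its right side there.
    obtain ⟨f, hf, hfe, ω, hω, -, hfω, hmin⟩ := exists_next_direction (u := D.w)
      (T := S.filter fun f => f.2 = e.1.2) hr (fun k hk => D.norm_w k (Finset.mem_filter.1 hk).1)
      (fun k hk l hl hkl => by
        by_contra hne
        obtain ⟨k1, k2⟩ := Finset.mem_filter.1 hk
        obtain ⟨l1, l2⟩ := Finset.mem_filter.1 hl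
        exact D.w_ne k1 l1 hne (k2.trans l2.symm) hkl) (Finset.mem_filter.2 ⟨e.2, rfl⟩)
      ⟨g, Finset.mem_filter.2 ⟨hg, hg1⟩, hg2⟩
    obtain ⟨hfS, hf2⟩ := Finset.mem_filter.1 hf
    have hεω : ε < ω := by
      by_contra hcon
      exact (hε e e.2 f hfS (Ne.symm hfe) (-ω) (by rw [abs_neg, abs_of_pos hω]; linarith)).2
        hf2.symm hfω
    refine ⟨⟨f, hfS⟩, hf2, fun h => hfe (Prod.ext h hf2), ?_⟩
    rw [hLL, hRR]
    let τ : ℝ → ℂ := fun t => D.py e.1.2 + D.w e / 2 * exp ((-(ε + t * (ω - 2 * ε)) : ℝ) * I)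
    have hτc : Continuous τ := by fun_prop
    have e0 : L' e = τ 0 := by simp [L', τ]
    have e1 : R' ⟨f, hfS⟩ = τ 1 := by
      simp only [R', τ]
      rw [hfω, hf2, mul_div_right_comm, mul_assoc, ← exp_add]
      push_cast
      ring_nf
    rw [e0, e1]
    refine D.winding_eq_of_path hS hτc fun k hk s hs t ht heq => ?_
    obtain ⟨a1, a2⟩ := D.of_mem_circle_right e.2 hk hs heq
    exact hmin k (Finset.mem_filter.2 ⟨hk, a1⟩) _ (hturn hεω ht).1 (hturn hεω ht).2 a2
  have hR : ∀ e : S, ∃ f : S, f.1.1 = e.1.1 ∧ f.1.2 ≠ e.1.2 ∧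
      D.winding A B (R e) = D.winding A B (L f) := by
    intro e
    obtain ⟨g, hg, hg1, hg2⟩ := hdx e e.2
    obtain ⟨f, hf, hfe, ω, hω, -, hfω, hmin⟩ := exists_next_direction (u := D.v)
      (T := S.filter fun f => f.1 = e.1.1) hr (fun k hk => D.norm_v k (Finset.mem_filter.1 hk).1)
      (fun k hk l hl hkl => by
        by_contra hne
        obtain ⟨k1, k2⟩ := Finset.mem_filter.1 hk
        obtain ⟨l1, l2⟩ := Finset.mem_filter.1 hl
        exact D.v_ne k1 l1 hne (k2.trans l2.symm) hkl) (Finset.mem_filter.2 ⟨e.2, rfl⟩)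
      ⟨g, Finset.mem_filter.2 ⟨hg, hg1⟩, hg2⟩
    obtain ⟨hfS, hf2⟩ := Finset.mem_filter.1 hf
    have hεω : ε < ω := by
      by_contra hcon
      exact (hε e e.2 f hfS (Ne.symm hfe) (-ω) (by rw [abs_neg, abs_of_pos hω]; linarith)).1
        hf2.symm hfω
    refine ⟨⟨f, hfS⟩, hf2, fun h => hfe (Prod.ext hf2 h), ?_⟩
    let τ : ℝ → ℂ := fun t => D.px e.1.1 + D.v e / 2 * exp ((-(ε + t * (ω - 2 * ε)) : ℝ) * I)
    have hτc : Continuous τ := by fun_prop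
    have e0 : R e = τ 0 := by simp [R, τ]
    have e1 : L ⟨f, hfS⟩ = τ 1 := by
      simp only [L, τ]
      rw [hfω, hf2, mul_div_right_comm, mul_assoc, ← exp_add]
      push_cast
      ring_nf
    rw [e0, e1]
    refine D.winding_eq_of_path hS hτc fun k hk s hs t ht heq => ?_
    obtain ⟨a1, a2⟩ := D.of_mem_circle_left e.2 hk hs heq
    exact hmin k (Finset.mem_filter.2 ⟨hk, a1⟩) _ (hturn hεω ht).1 (hturn hεω ht).2 a2
  have hmain := four_mul_finrank_add_one_le hne two_pi_I_ne_zero hL hR hcross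
  have hA : A.Nonempty := by
    obtain ⟨e, he⟩ := hne
    exact ⟨_, (Finset.mem_product.1 (hS he)).1⟩
  have := card_lt_finrank_ker_boundaryMap hS hA
  omega

end RadialDrawing

/-! ### Straightening arcs near the vertices -/

/-- A path that agrees with `Γ` in its middle third and is radial near its ends. -/
structure StraightenedPath (γ Γ : ℝ → ℂ) (a b v w : ℂ) (r : ℝ) : Prop where
  radial : RadialPath γ a b v w
  norm_left : ‖v‖ = r
  norm_right : ‖w‖ = r
  mid : ∀ t ∈ Icc (1 : ℝ) 2, ∃ s ∈ Ioo (0 : ℝ) 1, γ t = Γ s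
  far_left : ∀ t ∈ Icc (0 : ℝ) 3, 1 < t → r < ‖γ t - a‖
  far_right : ∀ t ∈ Icc (0 : ℝ) 3, t < 2 → r < ‖γ t - b‖

/-- `t₀` is the last time in the closed disc around `Γ 0`, and `t₁` the first time from `t₀` on in
the one around `Γ 1`. The discs are disjoint by `hab`, which forces `t₀ < t₁`. -/
theorem exists_last_exit {Γ : ℝ → ℂ} {r : ℝ} (hr : 0 < r) (hc : ContinuousOn Γ (Icc 0 1))
    (hab : 2 * r < ‖Γ 0 - Γ 1‖) :
    ∃ t₀ t₁ : ℝ, 0 < t₀ ∧ t₀ < t₁ ∧ t₁ < 1 ∧ ‖Γ t₀ - Γ 0‖ = r ∧ ‖Γ t₁ - Γ 1‖ = r ∧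
      (∀ t, t₀ < t → t ≤ 1 → r < ‖Γ t - Γ 0‖) ∧ ∀ t, t₀ ≤ t → t < t₁ → r < ‖Γ t - Γ 1‖ := by
  have hca : ContinuousOn (fun t => ‖Γ t - Γ 0‖) (Icc 0 1) := (hc.sub continuousOn_const).norm
  have hcb : ContinuousOn (fun t => ‖Γ t - Γ 1‖) (Icc 0 1) := (hc.sub continuousOn_const).norm
  have hK : IsCompact (Icc (0 : ℝ) 1 ∩ (fun t => ‖Γ t - Γ 0‖) ⁻¹' Iic r) :=
    isCompact_Icc.of_isClosed_subset (hca.preimage_isClosed_of_isClosed isClosed_Icc isClosed_Iic)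
      inter_subset_left
  obtain ⟨t₀, ⟨ht₀, ht₀r⟩, hmax⟩ := hK.exists_isGreatest ⟨0, by simp, by simp [hr.le]⟩
  have hout : ∀ t, t₀ < t → t ≤ 1 → r < ‖Γ t - Γ 0‖ := by
    intro t h1 h2
    by_contra hcon
    exact absurd (hmax ⟨⟨ht₀.1.trans h1.le, h2⟩, not_lt.1 hcon⟩) (not_le.2 h1)
  have h1 : r < ‖Γ 1 - Γ 0‖ := by rw [norm_sub_rev]; linarith
  have ht₀1 : t₀ < 1 := by
    rcases ht₀.2.lt_or_eq with h | h
    · exact h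
    · rw [h] at ht₀r
      exact absurd ht₀r (not_le.2 h1)
  have hr₀ : ‖Γ t₀ - Γ 0‖ = r := by
    obtain ⟨t, ht, hte⟩ := intermediate_value_Icc ht₀1.le
      (hca.mono (Icc_subset_Icc_left ht₀.1)) ⟨ht₀r, h1.le⟩
    have hte' : ‖Γ t - Γ 0‖ = r := hte
    rcases ht.1.lt_or_eq with h | h
    · linarith [hout t h ht.2]
    · rwa [h]
  have hfar : r < ‖Γ t₀ - Γ 1‖ := by
    have := norm_sub_le_norm_sub_add_norm_sub (Γ 0) (Γ t₀) (Γ 1)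
    rw [norm_sub_rev (Γ 0) (Γ t₀), hr₀] at this
    linarith
  have hK' : IsCompact (Icc t₀ 1 ∩ (fun t => ‖Γ t - Γ 1‖) ⁻¹' Iic r) :=
    isCompact_Icc.of_isClosed_subset
      ((hcb.mono (Icc_subset_Icc_left ht₀.1)).preimage_isClosed_of_isClosed isClosed_Icc
        isClosed_Iic) inter_subset_left
  obtain ⟨t₁, ⟨ht₁, ht₁r⟩, hmin⟩ := hK'.exists_isLeast ⟨1, ⟨ht₀1.le, le_rfl⟩, by simp [hr.le]⟩
  have hout' : ∀ t, t₀ ≤ t → t < t₁ → r < ‖Γ t - Γ 1‖ := by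
    intro t h1 h2
    by_contra hcon
    exact absurd (hmin ⟨⟨h1, h2.le.trans ht₁.2⟩, not_lt.1 hcon⟩) (not_le.2 h2)
  have h01 : t₀ < t₁ := by
    rcases ht₁.1.lt_or_eq with h | h
    · exact h
    · rw [← h] at ht₁r
      exact absurd ht₁r (not_le.2 hfar)
  have hr₁ : ‖Γ t₁ - Γ 1‖ = r := by
    obtain ⟨t, ht, hte⟩ := intermediate_value_Icc' h01.le
      (hcb.mono (Icc_subset_Icc ht₀.1 ht₁.2)) ⟨ht₁r, hfar.le⟩
    have hte' : ‖Γ t - Γ 1‖ = r := hte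
    rcases ht.2.lt_or_eq with h | h
    · linarith [hout' t ht.1 h]
    · rwa [← h]
  refine ⟨t₀, t₁, ?_, h01, ?_, hr₀, hr₁, hout, hout'⟩
  · rcases ht₀.1.lt_or_eq with h | h
    · exact h
    · rw [← h, sub_self, norm_zero] at hr₀
      linarith
  · rcases ht₁.2.lt_or_eq with h | h
    · exact h
    · rw [h, sub_self, norm_zero] at hr₁
      linarith

/-- Radii replace what comes before the last exit and after the following entry. The piece kept in
between is strictly outside both discs except at its ends, so the new path is still injective. -/
theorem exists_straightenedPath {Γ : ℝ → ℂ} {r : ℝ} (hr : 0 < r) (hc : ContinuousOn Γ (Icc 0 1))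
    (hi : InjOn Γ (Icc 0 1)) (hab : 2 * r < ‖Γ 0 - Γ 1‖) :
    ∃ (γ : ℝ → ℂ) (v w : ℂ), StraightenedPath γ Γ (Γ 0) (Γ 1) v w r := by
  obtain ⟨t₀, t₁, h0, h01, h1, hr₀, hr₁, hout, hout'⟩ := exists_last_exit hr hc hab
  set a := Γ 0
  set b := Γ 1
  set v := Γ t₀ - a with hv
  set w := Γ t₁ - b with hw
  let σ : ℝ → ℝ := fun t => t₀ + (t - 1) * (t₁ - t₀)
  have hσ : ∀ t ∈ Icc (1 : ℝ) 2, t₀ ≤ σ t ∧ σ t ≤ t₁ := fun t ht =>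
    ⟨by simp only [σ]; nlinarith [ht.1], by simp only [σ]; nlinarith [ht.2]⟩
  have hσ1 : ∀ t, 1 < t → t₀ < σ t := fun t ht => by
    have := mul_pos (sub_pos.2 ht) (sub_pos.2 h01)
    simp only [σ]; linarith
  have hσ2 : ∀ t, t < 2 → σ t < t₁ := fun t ht => by
    have := mul_pos (sub_pos.2 ht) (sub_pos.2 h01)
    simp only [σ]; nlinarith
  let γ : ℝ → ℂ := fun t => if t ≤ 1 then a + t * v else if t ≤ 2 then Γ (σ t) else b + (3 - t) * w
  have g1 : ∀ t, t ≤ 1 → γ t = a + t * v := fun t ht => if_pos ht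
  have g2 : ∀ t ∈ Icc (1 : ℝ) 2, γ t = Γ (σ t) := by
    intro t ht
    rcases ht.1.lt_or_eq with h | h
    · simp only [γ]
      rw [if_neg (not_le.2 h), if_pos ht.2]
    · rw [g1 t h.ge, ← h]
      simp [σ, hv]
  have g3 : ∀ t, 2 ≤ t → γ t = b + (3 - t) * w := by
    intro t ht
    rcases ht.lt_or_eq with h | h
    · simp only [γ]
      rw [if_neg (by linarith), if_neg (not_le.2 h)]
    · rw [← h, g2 2 (by norm_num)]
      simp only [σ, hw]
      norm_num
  have n1 : ∀ t, 0 ≤ t → t ≤ 1 → ‖γ t - a‖ = t * r := by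
    intro t h h'
    rw [g1 t h', add_sub_cancel_left, norm_mul, hr₀, norm_real, Real.norm_of_nonneg h]
  have n3 : ∀ t, 2 ≤ t → t ≤ 3 → ‖γ t - b‖ = (3 - t) * r := by
    intro t h h'
    have : ((3 - t : ℝ) : ℂ) = 3 - t := by push_cast; rfl
    rw [g3 t h, add_sub_cancel_left, norm_mul, hr₁, ← this, norm_real,
      Real.norm_of_nonneg (by linarith)]
  have farl : ∀ t ∈ Icc (0 : ℝ) 3, 1 < t → r < ‖γ t - a‖ := by
    intro t ht h
    rcases le_total t 2 with h2 | h2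
    · rw [g2 t ⟨h.le, h2⟩]
      exact hout _ (hσ1 t h) ((hσ t ⟨h.le, h2⟩).2.trans h1.le)
    · have e1 := n3 t h2 ht.2
      have e2 := norm_sub_le_norm_sub_add_norm_sub a (γ t) b
      rw [norm_sub_rev a (γ t)] at e2
      nlinarith
  have farr : ∀ t ∈ Icc (0 : ℝ) 3, t < 2 → r < ‖γ t - b‖ := by
    intro t ht h
    rcases le_total t 1 with h2 | h2
    · have e1 := n1 t ht.1 h2
      have e2 := norm_sub_le_norm_sub_add_norm_sub a (γ t) b
      rw [norm_sub_rev a (γ t)] at e2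
      nlinarith
    · rw [g2 t ⟨h2, h.le⟩]
      exact hout' _ (hσ t ⟨h2, h.le⟩).1 (hσ2 t h)
  have hv0 : v ≠ 0 := norm_pos_iff.1 (hr₀.symm ▸ hr)
  have hw0 : w ≠ 0 := norm_pos_iff.1 (hr₁.symm ▸ hr)
  have hσc : Continuous σ := by fun_prop
  have hlt : ∀ s ∈ Icc (0 : ℝ) 3, ∀ t ∈ Icc (0 : ℝ) 3, γ s = γ t → ¬ s < t := by
    intro s hs t ht heq hst
    rcases le_or_gt s 1 with s1 | s1
    · rcases le_or_gt t 1 with t1 | t1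
      · have e1 := n1 s hs.1 s1
        rw [heq, n1 t ht.1 t1] at e1
        nlinarith
      · have e1 := n1 s hs.1 s1
        rw [heq] at e1
        nlinarith [farl t ht t1]
    rcases le_or_gt 2 t with t2 | t2
    · rcases le_or_gt 2 s with s2 | s2
      · have e1 := n3 s s2 hs.2
        rw [heq, n3 t t2 ht.2] at e1
        nlinarith
      · have e1 := n3 t t2 ht.2
        rw [← heq] at e1
        nlinarith [farr s hs s2]
    · have ms : s ∈ Icc (1 : ℝ) 2 := ⟨s1.le, by linarith⟩
      have mt : t ∈ Icc (1 : ℝ) 2 := ⟨by linarith, t2.le⟩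
      rw [g2 s ms, g2 t mt] at heq
      have := hi ⟨h0.le.trans (hσ s ms).1, (hσ s ms).2.trans h1.le⟩
        ⟨h0.le.trans (hσ t mt).1, (hσ t mt).2.trans h1.le⟩ heq
      simp only [σ] at this
      nlinarith
  refine ⟨γ, v, w, ⟨?_, ?_, fun t ht => g1 t ht.2, fun t ht => g3 t ht.1, hv0, hw0, ?_, ?_⟩,
    hr₀, hr₁, ?_, farl, farr⟩
  · refine continuousOn_ite_Icc (by norm_num) (by norm_num) (by fun_prop)
      (continuousOn_ite_Icc (by norm_num) (by norm_num) (hc.comp hσc.continuousOn ?_)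
        (by fun_prop) ?_) ?_
    · exact fun t ht => ⟨h0.le.trans (hσ t ht).1, (hσ t ht).2.trans h1.le⟩
    · simp only [σ, hw]
      norm_num
    · rw [if_pos (by norm_num)]
      simp [σ, hv]
  · intro s hs t ht heq
    exact le_antisymm (not_lt.1 (hlt t ht s hs heq.symm)) (not_lt.1 (hlt s hs t ht heq))
  · intro t ht h
    rw [hr₀] at h
    rcases lt_trichotomy t 1 with h1 | h1 | h1
    · exact h1
    · rw [h1, n1 1 (by norm_num) le_rfl] at h
      linarith
    · linarith [farl t ht h1]
  · intro t ht h
    rw [hr₁] at h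
    rcases lt_trichotomy t 2 with h1 | h1 | h1
    · linarith [farr t ht h1]
    · rw [h1, n3 2 le_rfl (by norm_num)] at h
      linarith
    · exact h1
  · intro t ht
    exact ⟨σ t, ⟨h0.trans_le (hσ t ht).1, (hσ t ht).2.trans_lt h1⟩, g2 t ht⟩

/-- A path avoiding a point stays away from it. -/
theorem exists_pos_lt_norm_sub {Γ : ℝ → ℂ} (hc : ContinuousOn Γ (Icc 0 1)) {p : ℂ}
    (h : ∀ s ∈ Icc (0 : ℝ) 1, Γ s ≠ p) :
    ∃ δ : ℝ, 0 < δ ∧ ∀ s ∈ Icc (0 : ℝ) 1, δ ≤ ‖Γ s - p‖ := by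
  obtain ⟨s₀, hs₀, hmin⟩ := isCompact_Icc.exists_isMinOn (nonempty_Icc.2 zero_le_one)
    (hc.sub continuousOn_const).norm
  exact ⟨_, norm_pos_iff.2 (sub_ne_zero.2 (h s₀ hs₀)), fun s hs => hmin hs⟩

theorem exists_pos_forall_mem_finset {ι : Type*} (T : Finset ι) (P : ι → ℝ → Prop)
    (hmono : ∀ i, ∀ x y, 0 < x → x ≤ y → P i y → P i x) (h : ∀ i ∈ T, ∃ x, 0 < x ∧ P i x) :
    ∃ x, 0 < x ∧ ∀ i ∈ T, P i x := by
  classical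
  induction T using Finset.induction_on with
  | empty => exact ⟨1, one_pos, by simp⟩
  | insert i T _ ih =>
    obtain ⟨x, hx, hxT⟩ := ih fun j hj => h j (Finset.mem_insert_of_mem hj)
    obtain ⟨y, hy, hyi⟩ := h i (Finset.mem_insert_self i T)
    refine ⟨min x y, lt_min hx hy, fun j hj => ?_⟩
    rcases Finset.mem_insert.1 hj with rfl | hj
    · exact hmono _ _ _ (lt_min hx hy) (min_le_right _ _) hyi
    · exact hmono _ _ _ (lt_min hx hy) (min_le_left _ _) (hxT j hj)

/-- Every drawing of a finite bipartite graph can be made radial near the vertices. -/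
theorem nonempty_radialDrawing {X Y : Type*} {S : Finset (X × Y)} {px : X → ℂ} {py : Y → ℂ}
    {Γ : X × Y → ℝ → ℂ} (hc : ∀ e ∈ S, ContinuousOn (Γ e) (Icc 0 1))
    (hi : ∀ e ∈ S, InjOn (Γ e) (Icc 0 1)) (h0 : ∀ e ∈ S, Γ e 0 = px e.1)
    (h1 : ∀ e ∈ S, Γ e 1 = py e.2)
    (hx : ∀ e ∈ S, ∀ f ∈ S, f.1 ≠ e.1 → ∀ s ∈ Icc (0 : ℝ) 1, Γ f s ≠ px e.1)
    (hy : ∀ e ∈ S, ∀ f ∈ S, f.2 ≠ e.2 → ∀ s ∈ Icc (0 : ℝ) 1, Γ f s ≠ py e.2)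
    (hd : ∀ e ∈ S, ∀ f ∈ S, e ≠ f → ∀ s ∈ Ioo (0 : ℝ) 1, ∀ t ∈ Ioo (0 : ℝ) 1, Γ e s ≠ Γ f t) :
    Nonempty (RadialDrawing S) := by
  have I0 : (0 : ℝ) ∈ Icc (0 : ℝ) 1 := by norm_num
  have I1 : (1 : ℝ) ∈ Icc (0 : ℝ) 1 := by norm_num
  -- The factor 2 leaves room for the radii: they stay within `r` of their own vertex, hence more
  -- than `r` away from a point at distance above `2 * r` from it.
  obtain ⟨r, hr, hrS⟩ := exists_pos_forall_mem_finset (S ×ˢ S) (fun q x =>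
      (q.2.1 ≠ q.1.1 → ∀ s ∈ Icc (0 : ℝ) 1, 2 * x < ‖Γ q.2 s - px q.1.1‖) ∧
      (q.2.2 ≠ q.1.2 → ∀ s ∈ Icc (0 : ℝ) 1, 2 * x < ‖Γ q.2 s - py q.1.2‖) ∧
      2 * x < ‖Γ q.1 0 - Γ q.1 1‖)
    (fun q x y _ hxy h => ⟨fun hn s hs => by linarith [h.1 hn s hs],
      fun hn s hs => by linarith [h.2.1 hn s hs], by linarith [h.2.2]⟩) (by
    rintro ⟨e, f⟩ hef
    obtain ⟨he, hf⟩ := Finset.mem_product.1 hef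
    dsimp only at he hf ⊢
    have a1 : ∃ δ : ℝ, 0 < δ ∧ (f.1 ≠ e.1 → ∀ s ∈ Icc (0 : ℝ) 1, δ ≤ ‖Γ f s - px e.1‖) := by
      by_cases h : f.1 = e.1
      · exact ⟨1, one_pos, fun hn => absurd h hn⟩
      · obtain ⟨δ, hδ, hδ'⟩ := exists_pos_lt_norm_sub (hc f hf) (hx e he f hf h)
        exact ⟨δ, hδ, fun _ => hδ'⟩
    have a2 : ∃ δ : ℝ, 0 < δ ∧ (f.2 ≠ e.2 → ∀ s ∈ Icc (0 : ℝ) 1, δ ≤ ‖Γ f s - py e.2‖) := by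
      by_cases h : f.2 = e.2
      · exact ⟨1, one_pos, fun hn => absurd h hn⟩
      · obtain ⟨δ, hδ, hδ'⟩ := exists_pos_lt_norm_sub (hc f hf) (hy e he f hf h)
        exact ⟨δ, hδ, fun _ => hδ'⟩
    obtain ⟨δ₁, d1, d1'⟩ := a1
    obtain ⟨δ₂, d2, d2'⟩ := a2
    have d3 : 0 < ‖Γ e 0 - Γ e 1‖ := norm_pos_iff.2 (sub_ne_zero.2 fun h =>
      zero_ne_one (hi e he I0 I1 h))
    set δ₃ := ‖Γ e 0 - Γ e 1‖
    have m1 : min (min δ₁ δ₂) δ₃ ≤ δ₁ := (min_le_left _ _).trans (min_le_left _ _)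
    have m2 : min (min δ₁ δ₂) δ₃ ≤ δ₂ := (min_le_left _ _).trans (min_le_right _ _)
    have m3 : min (min δ₁ δ₂) δ₃ ≤ δ₃ := min_le_right _ _
    have m0 : 0 < min (min δ₁ δ₂) δ₃ := lt_min (lt_min d1 d2) d3
    exact ⟨min (min δ₁ δ₂) δ₃ / 3, by linarith,
      fun hn s hs => by linarith [d1' hn s hs], fun hn s hs => by linarith [d2' hn s hs],
      by linarith⟩)
  have hpair := fun e he f hf => hrS (e, f) (Finset.mem_product.2 ⟨he, hf⟩)
  dsimp only at hpair
  have hex : ∀ e ∈ S, ∃ (γ : ℝ → ℂ) (v w : ℂ),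
      StraightenedPath γ (Γ e) (px e.1) (py e.2) v w r := by
    intro e he
    rw [← h0 e he, ← h1 e he]
    exact exists_straightenedPath hr (hc e he) (hi e he) (hpair e he e he).2.2
  choose! γ v w hγ using hex
  have n1 : ∀ e ∈ S, ∀ t ∈ Icc (0 : ℝ) 1, ‖γ e t - px e.1‖ = t * r := by
    intro e he t ht
    rw [(hγ e he).radial.start t ht, add_sub_cancel_left, norm_mul, (hγ e he).norm_left, norm_real,
      Real.norm_of_nonneg ht.1]
  have n3 : ∀ e ∈ S, ∀ t ∈ Icc (2 : ℝ) 3, ‖γ e t - py e.2‖ = (3 - t) * r := by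
    intro e he t ht
    have : ((3 - t : ℝ) : ℂ) = 3 - t := by push_cast; rfl
    rw [(hγ e he).radial.finish t ht, add_sub_cancel_left, norm_mul, (hγ e he).norm_right, ← this,
      norm_real, Real.norm_of_nonneg (by linarith [ht.2])]
  have away : ∀ p : ℂ, ∀ f ∈ S, (∀ s ∈ Icc (0 : ℝ) 1, 2 * r < ‖Γ f s - p‖) →
      ∀ t ∈ Icc (0 : ℝ) 3, r < ‖γ f t - p‖ := by
    intro p f hf h t ht
    rcases le_total t 1 with t1 | t1
    · have e1 := n1 f hf t ⟨ht.1, t1⟩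
      have e2 := norm_sub_le_norm_sub_add_norm_sub (px f.1) (γ f t) p
      have e3 := h 0 I0
      rw [h0 f hf] at e3
      rw [norm_sub_rev (px f.1) (γ f t)] at e2
      nlinarith
    rcases le_total t 2 with t2 | t2
    · obtain ⟨s, hs, hst⟩ := (hγ f hf).mid t ⟨t1, t2⟩
      rw [hst]
      linarith [h s ⟨hs.1.le, hs.2.le⟩]
    · have e1 := n3 f hf t ⟨t2, ht.2⟩
      have e2 := norm_sub_le_norm_sub_add_norm_sub (py f.2) (γ f t) p
      have e3 := h 1 I1
      rw [h1 f hf] at e3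
      rw [norm_sub_rev (py f.2) (γ f t)] at e2
      nlinarith
  have awayl : ∀ e ∈ S, ∀ f ∈ S, f.1 ≠ e.1 → ∀ s ∈ Icc (0 : ℝ) 3, r < ‖γ f s - px e.1‖ :=
    fun e he f hf hn => away _ f hf ((hpair e he f hf).1 hn)
  have awayr : ∀ e ∈ S, ∀ f ∈ S, f.2 ≠ e.2 → ∀ s ∈ Icc (0 : ℝ) 3, r < ‖γ f s - py e.2‖ :=
    fun e he f hf hn => away _ f hf ((hpair e he f hf).2.1 hn)
  have mid_ne : ∀ e ∈ S, ∀ f ∈ S, e ≠ f → ∀ s ∈ Icc (1 : ℝ) 2, ∀ t ∈ Icc (1 : ℝ) 2,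
      γ e s ≠ γ f t := by
    intro e he f hf hef s hs t ht heq
    obtain ⟨s', hs', hss⟩ := (hγ e he).mid s hs
    obtain ⟨t', ht', htt⟩ := (hγ f hf).mid t ht
    exact hd e he f hf hef s' hs' t' ht' (by rw [← hss, ← htt, heq])
  have dl : ∀ e ∈ S, ∀ f ∈ S, e ≠ f → ∀ s ∈ Icc (0 : ℝ) 1, ∀ t ∈ Icc (0 : ℝ) 3,
      γ e s = γ f t → s = 0 ∧ t = 0 := by
    intro e he f hf hef s hs t ht heq
    have e1 := n1 e he s hs
    rw [heq] at e1
    have e2 : s * r ≤ r := by nlinarith [hs.2]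
    by_cases hfe : f.1 = e.1
    · rcases le_or_gt t 1 with t1 | t1
      · rw [← hfe, n1 f hf t ⟨ht.1, t1⟩] at e1
        obtain rfl : t = s := mul_right_cancel₀ hr.ne' e1
        rw [(hγ e he).radial.start t hs, (hγ f hf).radial.start t hs, hfe] at heq
        by_cases ht0 : t = 0
        · exact ⟨ht0, ht0⟩
        · exfalso
          -- Equal directions would give both edges the same point at parameter 1, which already
          -- belongs to the interiors of the disjoint original arcs.
          have hvv : v e = v f := mul_left_cancel₀ (ofReal_ne_zero.2 ht0) (add_left_cancel heq)
          refine mid_ne e he f hf hef 1 (by norm_num) 1 (by norm_num) ?_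
          rw [(hγ e he).radial.start 1 (by norm_num), (hγ f hf).radial.start 1 (by norm_num), hfe,
            hvv]
      · have := (hγ f hf).far_left t ht t1
        rw [hfe] at this
        linarith
    · linarith [awayl e he f hf hfe t ht]
  have dr : ∀ e ∈ S, ∀ f ∈ S, e ≠ f → ∀ s ∈ Icc (2 : ℝ) 3, ∀ t ∈ Icc (0 : ℝ) 3,
      γ e s = γ f t → s = 3 ∧ t = 3 := by
    intro e he f hf hef s hs t ht heq
    have e1 := n3 e he s hs
    rw [heq] at e1
    have e2 : (3 - s) * r ≤ r := by nlinarith [hs.1]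
    by_cases hfe : f.2 = e.2
    · rcases le_or_gt 2 t with t1 | t1
      · rw [← hfe, n3 f hf t ⟨t1, ht.2⟩] at e1
        obtain rfl : t = s := by linarith [mul_right_cancel₀ hr.ne' e1]
        rw [(hγ e he).radial.finish t hs, (hγ f hf).radial.finish t hs, hfe] at heq
        by_cases ht0 : t = 3
        · exact ⟨ht0, ht0⟩
        · exfalso
          have h3 : (3 - t : ℂ) ≠ 0 := by
            have : ((3 - t : ℝ) : ℂ) ≠ 0 := ofReal_ne_zero.2 fun h => ht0 (by linarith)
            simpa using this
          have hww : w e = w f := mul_left_cancel₀ h3 (add_left_cancel heq)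
          refine mid_ne e he f hf hef 2 (by norm_num) 2 (by norm_num) ?_
          rw [(hγ e he).radial.finish 2 (by norm_num), (hγ f hf).radial.finish 2 (by norm_num),
            hfe, hww]
      · have := (hγ f hf).far_right t ht t1
        rw [hfe] at this
        linarith
    · linarith [awayr e he f hf hfe t ht]
  exact ⟨{
    px := px
    py := py
    v := v
    w := w
    γ := γ
    r := r
    r_pos := hr
    norm_v := fun e he => (hγ e he).norm_left
    norm_w := fun e he => (hγ e he).norm_right
    radial := fun e he => (hγ e he).radial
    disjoint := by
      intro e he f hf hef s hs t ht heq
      rcases le_total s 1 with s1 | s1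
      · exact Or.inl (dl e he f hf hef s ⟨hs.1, s1⟩ t ht heq)
      rcases le_total t 1 with t1 | t1
      · exact Or.inl (dl f hf e he hef.symm t ⟨ht.1, t1⟩ s hs heq.symm).symm
      rcases le_total 2 s with s2 | s2
      · exact Or.inr (dr e he f hf hef s ⟨s2, hs.2⟩ t ht heq)
      rcases le_total 2 t with t2 | t2
      · exact Or.inr (dr f hf e he hef.symm t ⟨t2, ht.2⟩ s hs heq.symm).symm
      exact absurd heq (mid_ne e he f hf hef s ⟨s1, s2⟩ t ⟨t1, t2⟩)
    away_left := fun e he f hf hn s hs => (awayl e he f hf hn s hs).le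
    away_right := fun e he f hf hn s hs => (awayr e he f hf hn s hs).le }⟩

/-! ### The edge bound for planar bipartite graphs -/

/-- The restriction of a radial drawing to a subgraph. -/
def RadialDrawing.restrict {X Y : Type*} {S T : Finset (X × Y)} (D : RadialDrawing S)
    (h : T ⊆ S) : RadialDrawing T where
  px := D.px
  py := D.py
  v := D.v
  w := D.w
  γ := D.γ
  r := D.r
  r_pos := D.r_pos
  norm_v e he := D.norm_v e (h he)
  norm_w e he := D.norm_w e (h he)
  radial e he := D.radial e (h he)
  disjoint e he f hf := D.disjoint e (h he) f (h hf)
  away_left e he f hf := D.away_left e (h he) f (h hf)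
  away_right e he f hf := D.away_right e (h he) f (h hf)

/-- A bipartite graph with a radial drawing and `n ≥ 3` vertices has at most `2 n - 4` edges. -/
theorem RadialDrawing.card_edges_add_four_le {X Y : Type*} [DecidableEq X] [DecidableEq Y]
    {S : Finset (X × Y)} (D : RadialDrawing S) {A : Finset X} {B : Finset Y} (hS : S ⊆ A ×ˢ B)
    (hA : A.Nonempty) (hB : B.Nonempty) (h3 : 3 ≤ A.card + B.card) :
    S.card + 4 ≤ 2 * (A.card + B.card) := by
  induction hn : A.card + B.card using Nat.strong_induction_on generalizing S A B with
  | _ n ih =>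
  subst hn
  have hAc := hA.card_pos
  have hBc := hB.card_pos
  have hprod := Finset.card_le_card hS
  rw [Finset.card_product] at hprod
  -- Stars are settled by counting. Afterwards both parts have at least two vertices, so deleting
  -- one leaves at least three and keeps both parts nonempty.
  by_cases hA1 : A.card = 1
  · rw [hA1, one_mul] at hprod
    omega
  by_cases hB1 : B.card = 1
  · rw [hB1, mul_one] at hprod
    omega
  by_cases hx : ∃ x ∈ A, (S.filter fun e => e.1 = x).card ≤ 1
  · obtain ⟨x, hxA, hxc⟩ := hx
    have hcard := Finset.card_filter_add_card_filter_not (s := S) (fun e => e.1 = x)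
    have hAe := Finset.card_erase_of_mem hxA
    have := ih _ (by omega) (D.restrict (Finset.filter_subset (fun e => ¬ e.1 = x) S))
      (A := A.erase x) (B := B) (fun e he => by
        obtain ⟨he, hex⟩ := Finset.mem_filter.1 he
        have := Finset.mem_product.1 (hS he)
        exact Finset.mem_product.2 ⟨Finset.mem_erase.2 ⟨hex, this.1⟩, this.2⟩)
      (Finset.card_pos.1 (by omega)) hB (by omega) rfl
    omega
  by_cases hy : ∃ y ∈ B, (S.filter fun e => e.2 = y).card ≤ 1
  · obtain ⟨y, hyB, hyc⟩ := hy
    have hcard := Finset.card_filter_add_card_filter_not (s := S) (fun e => e.2 = y)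
    have hBe := Finset.card_erase_of_mem hyB
    have := ih _ (by omega) (D.restrict (Finset.filter_subset (fun e => ¬ e.2 = y) S))
      (A := A) (B := B.erase y) (fun e he => by
        obtain ⟨he, hex⟩ := Finset.mem_filter.1 he
        have := Finset.mem_product.1 (hS he)
        exact Finset.mem_product.2 ⟨this.1, Finset.mem_erase.2 ⟨hex, this.2⟩⟩)
      hA (Finset.card_pos.1 (by omega)) (by omega) rfl
    omega
  push Not at hx hy
  refine D.card_add_four_le hS ?_ (fun e he => ?_) (fun e he => ?_)
  · obtain ⟨x, hxA⟩ := hA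
    have := hx x hxA
    obtain ⟨e, he⟩ := Finset.card_pos.1 (lt_trans one_pos this)
    exact ⟨e, (Finset.mem_filter.1 he).1⟩
  · obtain ⟨f, hf, hfe⟩ := Finset.exists_mem_ne (hx e.1 (Finset.mem_product.1 (hS he)).1) e
    exact ⟨f, (Finset.mem_filter.1 hf).1, (Finset.mem_filter.1 hf).2, hfe⟩
  · obtain ⟨f, hf, hfe⟩ := Finset.exists_mem_ne (hy e.2 (Finset.mem_product.1 (hS he)).2) e
    exact ⟨f, (Finset.mem_filter.1 hf).1, (Finset.mem_filter.1 hf).2, hfe⟩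

/-- A planar bipartite graph with parts of sizes `m` and `n` has at most `2 (m + n) - 4` edges. -/
theorem card_edges_add_four_le_of_isPlanar {X Y : Type*} [Fintype X] [Fintype Y] [DecidableEq X]
    [DecidableEq Y] [Nonempty X] [Nonempty Y]
    (h3 : 3 ≤ Fintype.card X + Fintype.card Y) {H : (completeBipartiteGraph X Y).Subgraph}
    (hH : IsPlanar H.coe) {S : Finset (X × Y)}
    (hS : ∀ e ∈ S, H.Adj (Sum.inl e.1) (Sum.inr e.2)) :
    S.card + 4 ≤ 2 * (Fintype.card X + Fintype.card Y) := by
  classical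
  obtain ⟨D⟩ := hH
  let φ : Plane ≃ₗᵢ[ℝ] ℂ := Complex.orthonormalBasisOneI.repr.symm
  -- The value 0 outside `H` is arbitrary: such a vertex is an end of no edge in `S`.
  let q : X ⊕ Y → ℂ := fun w => if hw : w ∈ H.verts then φ (D.pos ⟨w, hw⟩) else 0
  have hq : ∀ w (hw : w ∈ H.verts), q w = φ (D.pos ⟨w, hw⟩) := fun w hw => dif_pos hw
  have vl : ∀ e ∈ S, Sum.inl e.1 ∈ H.verts := fun e he => H.edge_vert (hS e he)
  have vr : ∀ e ∈ S, Sum.inr e.2 ∈ H.verts := fun e he => H.edge_vert (hS e he).symm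
  have hex : ∀ e ∈ S, ∃ Γ : ℝ → ℂ, ContinuousOn Γ (Icc 0 1) ∧ InjOn Γ (Icc 0 1) ∧
      Γ 0 = q (Sum.inl e.1) ∧ Γ 1 = q (Sum.inr e.2) ∧
      ∀ (he : e ∈ S), ∀ s ∈ Icc (0 : ℝ) 1,
        ∃ p ∈ D.arc s(⟨_, vl e he⟩, ⟨_, vr e he⟩), Γ s = φ p := by
    intro e he
    obtain ⟨γ, hγi, hγr⟩ := D.isArc ⟨_, vl e he⟩ ⟨_, vr e he⟩ (hS e he)
    refine ⟨fun t => φ (γ.extend t), (φ.continuous.comp γ.continuous_extend).continuousOn, ?_, ?_,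
      ?_, ?_⟩
    · intro s hs t ht hst
      have h1 := φ.injective hst
      rw [γ.extend_apply hs, γ.extend_apply ht] at h1
      exact congrArg Subtype.val (hγi h1)
    · simp [hq _ (vl e he)]
    · simp [hq _ (vr e he)]
    · intro _ s hs
      refine ⟨γ.extend s, ?_, rfl⟩
      rw [γ.extend_apply hs, ← hγr]
      exact mem_range_self _
  choose! Γ hc hi h0 h1 harc using hex
  have hedge : ∀ e (he : e ∈ S), s((⟨_, vl e he⟩ : H.verts), ⟨_, vr e he⟩) ∈ H.coe.edgeSet :=
    fun e he => hS e he
  have hvert : ∀ e ∈ S, ∀ s ∈ Icc (0 : ℝ) 1, ∀ w ∈ H.verts, Γ e s = q w →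
      w = Sum.inl e.1 ∨ w = Sum.inr e.2 := by
    intro e he s hs w hw h
    obtain ⟨p, hp, hsp⟩ := harc e he he s hs
    rw [hsp, hq w hw] at h
    rw [φ.injective h] at hp
    have := D.mem_of_pos_mem _ (hedge e he) _ hp
    simpa [Sym2.mem_iff] using this
  obtain ⟨R⟩ := nonempty_radialDrawing (S := S) (px := fun x => q (Sum.inl x))
    (py := fun y => q (Sum.inr y)) (Γ := Γ) hc hi h0 h1
    (fun e he f hf hn s hs h => by
      rcases hvert f hf s hs _ (vl e he) h with h | h
      · exact hn (Sum.inl_injective h).symm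
      · exact Sum.inl_ne_inr h)
    (fun e he f hf hn s hs h => by
      rcases hvert f hf s hs _ (vr e he) h with h | h
      · exact Sum.inr_ne_inl h
      · exact hn (Sum.inr_injective h).symm)
    (fun e he f hf hn s hs t ht h => by
      obtain ⟨p, hp, hsp⟩ := harc e he he s ⟨hs.1.le, hs.2.le⟩
      obtain ⟨p', hp', htp⟩ := harc f hf hf t ⟨ht.1.le, ht.2.le⟩
      obtain rfl : p = p' := φ.injective (by rw [← hsp, ← htp, h])
      obtain ⟨w, rfl⟩ := D.inter_subset _ (hedge e he) _ (hedge f hf) (fun hef => hn (by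
        rw [Sym2.eq_iff] at hef
        simp only [Subtype.mk.injEq, Sum.inl.injEq, Sum.inr.injEq, reduceCtorEq, and_self,
          or_false] at hef
        exact Prod.ext hef.1 hef.2)) ⟨hp, hp'⟩
      rw [← hq w w.2] at hsp
      -- The common point is a vertex on `e`, hence an end of `e`, and injectivity excludes this at
      -- an interior parameter.
      rcases hvert e he s ⟨hs.1.le, hs.2.le⟩ w w.2 hsp with hw | hw
      · rw [hw, ← h0 e he] at hsp
        exact hs.1.ne' (hi e he ⟨hs.1.le, hs.2.le⟩ (by norm_num) hsp)
      · rw [hw, ← h1 e he] at hsp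
        exact hs.2.ne (hi e he ⟨hs.1.le, hs.2.le⟩ (by norm_num) hsp))
  exact R.card_edges_add_four_le (A := Finset.univ) (B := Finset.univ) (fun _ _ => by simp)
    Finset.univ_nonempty Finset.univ_nonempty h3

/-- A lower bound for the number of planar subgraphs covering a complete bipartite graph. -/
theorem card_mul_card_le_of_isUnionOfPlanar {X Y : Type*} [Fintype X] [Fintype Y]
    [Nonempty X] [Nonempty Y] (h3 : 3 ≤ Fintype.card X + Fintype.card Y) {k : ℕ}
    (h : IsUnionOfPlanar (completeBipartiteGraph X Y) k) :
    Fintype.card X * Fintype.card Y ≤ k * (2 * (Fintype.card X + Fintype.card Y) - 4) := by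
  classical
  obtain ⟨H, hH, hsup⟩ := h
  let S : Fin k → Finset (X × Y) := fun i =>
    Finset.univ.filter fun e => (H i).Adj (Sum.inl e.1) (Sum.inr e.2)
  have hcov : (Finset.univ : Finset (X × Y)) ⊆ Finset.univ.biUnion S := by
    intro e _
    have h1 : (⨆ i, H i).Adj (Sum.inl e.1) (Sum.inr e.2) := by
      rw [hsup]
      simp
    rw [SimpleGraph.Subgraph.iSup_adj] at h1
    obtain ⟨i, hi⟩ := h1
    exact Finset.mem_biUnion.2 ⟨i, Finset.mem_univ _, Finset.mem_filter.2 ⟨Finset.mem_univ _, hi⟩⟩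
  calc Fintype.card X * Fintype.card Y = (Finset.univ : Finset (X × Y)).card := by
        rw [Finset.card_univ, Fintype.card_prod]
    _ ≤ (Finset.univ.biUnion S).card := Finset.card_le_card hcov
    _ ≤ (Finset.univ : Finset (Fin k)).card * (2 * (Fintype.card X + Fintype.card Y) - 4) := by
        refine Finset.card_biUnion_le_card_mul _ _ _ fun i _ => ?_
        have := card_edges_add_four_le_of_isPlanar h3 (hH i) (S := S i)
          fun e he => (Finset.mem_filter.1 he).2
        omega
    _ = _ := by rw [Finset.card_univ, Fintype.card_fin]

end LowerBound

/-! ### Upper bound: straight drawings with vertices on two axes -/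

section UpperBound
open Set

theorem isArc_segment {p q : Plane} (h : p ≠ q) : IsArc (segment ℝ p q) p q := by
  refine ⟨⟨⟨fun t => AffineMap.lineMap p q (t : ℝ), by fun_prop⟩, by simp, by simp⟩, ?_, ?_⟩
  · intro s t hst
    exact Subtype.ext (AffineMap.lineMap_injective ℝ h hst)
  · rw [segment_eq_image_lineMap]
    ext z
    simp [mem_image]

theorem mem_segment_axes {x y : ℝ} {p : Plane} :
    p ∈ segment ℝ (!₂[x, 0] : Plane) !₂[0, y] ↔
      ∃ s t : ℝ, 0 ≤ s ∧ 0 ≤ t ∧ s + t = 1 ∧ p 0 = s * x ∧ p 1 = t * y := by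
  constructor
  · rintro ⟨s, t, hs, ht, hst, rfl⟩
    exact ⟨s, t, hs, ht, hst, by simp, by simp⟩
  · rintro ⟨s, t, hs, ht, hst, h0, h1⟩
    refine ⟨s, t, hs, ht, hst, ?_⟩
    ext i
    fin_cases i
    · simp [h0]
    · simp [h1]

/-- A bipartite graph whose vertices can be placed on the two coordinate axes such that the edges
are monotone in the distances from the origin is planar. -/
theorem isPlanar_of_monotone {X Y : Type*} (H : (completeBipartiteGraph X Y).Subgraph)
    {ξ : X → ℝ} {η : Y → ℝ} (hξ : Function.Injective ξ) (hη : Function.Injective η)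
    (hξ0 : ∀ x, ξ x ≠ 0) (hη0 : ∀ y, η y ≠ 0)
    (hmono : ∀ x y x' y', H.Adj (Sum.inl x) (Sum.inr y) → H.Adj (Sum.inl x') (Sum.inr y') →
      |ξ x| < |ξ x'| → |η y| ≤ |η y'|) : IsPlanar H.coe := by
  let P : X ⊕ Y → Plane := Sum.elim (fun x => !₂[ξ x, 0]) (fun y => !₂[0, η y])
  have hP : Function.Injective P := by
    rintro (x | y) (x' | y') h
    · have := congrArg (fun p : Plane => p 0) h
      exact congrArg Sum.inl (hξ (by simpa [P] using this))
    · have := congrArg (fun p : Plane => p 0) h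
      exact absurd (by simpa [P] using this) (hξ0 x)
    · have := congrArg (fun p : Plane => p 1) h
      exact absurd (by simpa [P] using this) (hη0 y)
    · have := congrArg (fun p : Plane => p 1) h
      exact congrArg Sum.inr (hη (by simpa [P] using this))
  let arc : Sym2 H.verts → Set Plane :=
    Sym2.lift ⟨fun u v => segment ℝ (P u) (P v), fun _ _ => segment_symm ℝ _ _⟩
  have harc : ∀ u v, arc s(u, v) = segment ℝ (P u) (P v) := fun u v => rfl
  have hedge : ∀ e ∈ H.coe.edgeSet, ∃ (x : X) (y : Y) (hx : Sum.inl x ∈ H.verts)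
      (hy : Sum.inr y ∈ H.verts), H.Adj (Sum.inl x) (Sum.inr y) ∧
        e = s((⟨_, hx⟩ : H.verts), ⟨_, hy⟩) := by
    intro e
    induction e using Sym2.ind with
    | _ u v =>
    intro h
    have h' : H.Adj u.1 v.1 := h
    obtain ⟨u, hu⟩ := u
    obtain ⟨v, hv⟩ := v
    have hG := H.adj_sub h'
    rcases u with x | y <;> rcases v with x' | y'
    · simp at hG
    · exact ⟨x, y', hu, hv, h', rfl⟩
    · exact ⟨x', y, hv, hu, h'.symm, Sym2.eq_swap⟩
    · simp at hG
  refine ⟨⟨fun w => P w, arc, hP.comp Subtype.val_injective, fun u v h => ?_, ?_, ?_⟩⟩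
  · exact isArc_segment fun h' => h.ne (Subtype.ext (hP h'))
  · intro e he w hw
    obtain ⟨x, y, hx, hy, -, rfl⟩ := hedge e he
    rw [harc] at hw
    obtain ⟨s, t, hs, ht, hst, h0, h1⟩ := mem_segment_axes.1 hw
    rw [Sym2.mem_iff]
    obtain ⟨x' | y', hw'⟩ := w
    · left
      have ht0 : t = 0 := by simpa [P, hη0] using h1.symm
      obtain rfl : s = 1 := by linarith
      have : ξ x' = ξ x := by simpa [P] using h0
      exact Subtype.ext (congrArg Sum.inl (hξ this))
    · right
      have hs0 : s = 0 := by simpa [P, hξ0] using h0.symm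
      obtain rfl : t = 1 := by linarith
      have : η y' = η y := by simpa [P] using h1
      exact Subtype.ext (congrArg Sum.inr (hη this))
  · rintro e he f hf hef p ⟨hpe, hpf⟩
    obtain ⟨x, y, hx, hy, hxy, rfl⟩ := hedge e he
    obtain ⟨x', y', hx', hy', hxy', rfl⟩ := hedge f hf
    rw [harc] at hpe hpf
    obtain ⟨s, t, hs, ht, hst, h0, h1⟩ := mem_segment_axes.1 hpe
    obtain ⟨s', t', hs', ht', hst', h0', h1'⟩ := mem_segment_axes.1 hpf
    rcases hs.eq_or_lt with rfl | hs
    · obtain rfl : t = 1 := by linarith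
      refine ⟨⟨_, hy⟩, ?_⟩
      ext i
      fin_cases i
      · simp [P, h0]
      · simp [P, h1]
    rcases ht.eq_or_lt with rfl | ht
    · obtain rfl : s = 1 := by linarith
      refine ⟨⟨_, hx⟩, ?_⟩
      ext i
      fin_cases i
      · simp [P, h0]
      · simp [P, h1]
    -- Two segments with a common interior point: if `|ξ x| < |ξ x'|`, then `s' < s`, so `t < t'`
    -- and `|η y| > |η y'|`, against `hmono`. By symmetry the weights agree, and then so do the
    -- edges.
    exfalso
    have hX : s * ξ x = s' * ξ x' := h0.symm.trans h0'
    have hY : t * η y = t' * η y' := h1.symm.trans h1'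
    have hXa : s * |ξ x| = s' * |ξ x'| := by
      have := congrArg abs hX
      rwa [abs_mul, abs_mul, abs_of_nonneg hs.le, abs_of_nonneg hs'] at this
    have hYa : t * |η y| = t' * |η y'| := by
      have := congrArg abs hY
      rwa [abs_mul, abs_mul, abs_of_nonneg ht.le, abs_of_nonneg ht'] at this
    have p1 := abs_pos.2 (hξ0 x)
    have p2 := abs_pos.2 (hξ0 x')
    have p3 := abs_pos.2 (hη0 y)
    have p4 := abs_pos.2 (hη0 y')
    have hs's : s' = s := by
      rcases lt_trichotomy |ξ x| |ξ x'| with h | h | h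
      · exfalso
        have hm := hmono x y x' y' hxy hxy' h
        have h2 : s' < s := by
          by_contra hcon
          nlinarith
        nlinarith
      · rw [h] at hXa
        exact (mul_right_cancel₀ p2.ne' hXa).symm
      · exfalso
        have hm := hmono x' y' x y hxy' hxy h
        have h2 : s < s' := by
          by_contra hcon
          nlinarith
        nlinarith
    have ht't : t' = t := by linarith
    rw [hs's] at hX
    rw [ht't] at hY
    apply hef
    have hxx := hξ (mul_left_cancel₀ hs.ne' hX)
    have hyy := hη (mul_left_cancel₀ ht.ne' hY)
    subst hxx hyy
    rfl

/-! ### Covering a grid by staircases -/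

section Staircase

/-- The starting points of the steps of the staircases that cover an `a × b` grid. -/
def stairStart (b t m : ℤ) : ℤ := m * b / t

/-- The cyclic position of the column `c` in the staircase with number `k`. -/
def stairColumn (b t k c : ℤ) : ℤ := (c - stairStart b t k) % b

/-- The cell in row `i` and column `c` belongs to the staircase with number `k`. -/
def StairCell (b t k i c : ℤ) : Prop :=
  stairStart b t (k + i) ≤ stairStart b t k + stairColumn b t k c + i ∧
    stairStart b t k + stairColumn b t k c + i < stairStart b t (k + i + 1)

variable {b t : ℤ}

/-- As `t ≤ b`, each step has length at least one. -/
theorem stairStart_add_le (ht : 0 < t) (htb : t ≤ b) (m : ℤ) {d : ℤ} (hd : 0 ≤ d) :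
    stairStart b t m + d ≤ stairStart b t (m + d) := by
  rw [stairStart, stairStart, ← Int.add_mul_ediv_right _ _ ht.ne']
  refine Int.ediv_le_ediv ht ?_
  nlinarith

/-- Any `t` consecutive steps fill one period of `b` columns. -/
theorem stairStart_add_mul (ht : 0 < t) (m l : ℤ) :
    stairStart b t (m + t * l) = stairStart b t m + b * l := by
  rw [stairStart, stairStart, ← Int.add_mul_ediv_right _ _ ht.ne']
  congr 1
  ring

/-- Relative to `stairStart b t k`, the last position allowed in row `i` is `stairStart b t (k + i +
1) - i - 1`, which is also the first one allowed in row `i + 1`. -/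
theorem StairCell.mono (ht : 0 < t) (htb : t ≤ b) {k i c i' c' : ℤ} (h : StairCell b t k i c)
    (h' : StairCell b t k i' c') (hi : i < i') : stairColumn b t k c ≤ stairColumn b t k c' := by
  have h1 := stairStart_add_le ht htb (k + i + 1) (d := i' - i - 1) (by omega)
  rw [show k + i + 1 + (i' - i - 1) = k + i' by ring] at h1
  have h2 := h.2
  have h3 := h'.1
  omega

/-- In row `i` the steps `k + i`, with `k` running modulo `t`, tile the integers modulo `b`, so one
of them contains `c + i`. By `hab`, the starts advance by at most `a + b - 1` over `a` steps;
therefore the staircase fits into `b` columns and the cyclic position needs no further wrapping. -/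
theorem exists_stairCell (ht : 0 < t) (htb : t ≤ b) {a : ℤ} (hab : a * b ≤ t * (a + b - 1))
    {i : ℤ} (hi0 : 0 ≤ i) (hia : i < a) (c : ℤ) :
    ∃ k, 0 ≤ k ∧ k < t ∧ StairCell b t k i c := by
  have hb : 0 < b := ht.trans_le htb
  -- the step containing `c + i`
  obtain ⟨j, hj, hj'⟩ : ∃ j, stairStart b t j ≤ c + i ∧ c + i < stairStart b t (j + 1) := by
    -- This is the largest `j` with `j * b < (c + i + 1) * t`, that is, with `stairStart b t j ≤ c +
    -- i`.
    refine ⟨((c + i + 1) * t - 1) / b, ?_, ?_⟩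
    · have := Int.ediv_mul_le ((c + i + 1) * t - 1) hb.ne'
      rw [stairStart, ← Int.lt_add_one_iff, Int.ediv_lt_iff_lt_mul ht]
      linarith
    · have := Int.lt_ediv_add_one_mul_self ((c + i + 1) * t - 1) hb
      rw [stairStart, ← Int.add_one_le_iff, Int.le_ediv_iff_mul_le ht]
      linarith
  have hk := Int.emod_add_mul_ediv (j - i) t
  set k := (j - i) % t
  set l := (j - i) / t
  have e1 : stairStart b t j = stairStart b t (k + i) + b * l := by
    rw [← stairStart_add_mul ht]
    congr 1
    linarith
  have e2 : stairStart b t (j + 1) = stairStart b t (k + i + 1) + b * l := by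
    rw [← stairStart_add_mul ht]
    congr 1
    linarith
  have u1 := stairStart_add_le ht htb k hi0
  have u2 := stairStart_add_le ht htb (k + i + 1) (d := a - i - 1) (by omega)
  rw [show k + i + 1 + (a - i - 1) = k + a by ring] at u2
  have u3 : stairStart b t (k + a) ≤ stairStart b t k + (a + b - 1) := by
    rw [stairStart, stairStart, ← Int.add_mul_ediv_right _ _ ht.ne']
    refine Int.ediv_le_ediv ht ?_
    linarith
  have hcol : stairColumn b t k c = c - b * l - stairStart b t k := by
    rw [stairColumn, show c - stairStart b t k = (c - b * l - stairStart b t k) + b * l by ring,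
      Int.add_mul_emod_self_left]
    exact Int.emod_eq_of_lt (by linarith) (by linarith)
  exact ⟨k, Int.emod_nonneg _ ht.ne', Int.emod_lt_of_pos _ ht,
    by rw [hcol]; linarith, by rw [hcol]; linarith⟩

theorem stairColumn_nonneg (hb : 0 < b) (k c : ℤ) : 0 ≤ stairColumn b t k c :=
  Int.emod_nonneg _ hb.ne'

theorem stairColumn_injOn (k : ℤ) {c c' : ℤ} (hc : 0 ≤ c) (hcb : c < b) (hc' : 0 ≤ c')
    (hcb' : c' < b) (h : stairColumn b t k c = stairColumn b t k c') : c = c' := by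
  have h1 : c ≡ c' [ZMOD b] := by
    have : c - stairStart b t k ≡ c' - stairStart b t k [ZMOD b] := h
    simpa using this.add_right (stairStart b t k)
  rw [Int.ModEq, Int.emod_eq_of_lt hc hcb, Int.emod_eq_of_lt hc' hcb'] at h1
  exact h1

end Staircase

/-! ### Doubling rows and columns -/

/-- The coordinate on an axis of a vertex of a doubled graph: the copies of a vertex lie opposite
to each other. -/
noncomputable def doubledCoord (f : ℤ → ℤ) (n : ℕ) : ℝ :=
  (-1) ^ n * ((f ((n / 2 : ℕ) : ℤ) : ℝ) + 1)

theorem abs_doubledCoord {f : ℤ → ℤ} {n : ℕ} (hf : 0 ≤ f ((n / 2 : ℕ) : ℤ)) :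
    |doubledCoord f n| = (f ((n / 2 : ℕ) : ℤ) : ℝ) + 1 := by
  have : (0 : ℝ) ≤ f ((n / 2 : ℕ) : ℤ) := by exact_mod_cast hf
  rw [doubledCoord, abs_mul, abs_pow, abs_neg, abs_one, one_pow, one_mul, abs_of_nonneg]
  linarith

theorem doubledCoord_ne_zero {f : ℤ → ℤ} {n : ℕ} (hf : 0 ≤ f ((n / 2 : ℕ) : ℤ)) :
    doubledCoord f n ≠ 0 := by
  rw [← abs_pos, abs_doubledCoord hf]
  have : (0 : ℝ) ≤ f ((n / 2 : ℕ) : ℤ) := by exact_mod_cast hf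
  linarith

/-- The absolute value recovers `n / 2` and the sign recovers the parity of `n`. -/
theorem doubledCoord_injective {f : ℤ → ℤ} {a : ℕ} (hf : ∀ c, 0 ≤ f c)
    (hinj : ∀ c c' : ℤ, 0 ≤ c → c < a → 0 ≤ c' → c' < a → f c = f c' → c = c') :
    Function.Injective fun n : Fin (2 * a) => doubledCoord f n := by
  intro m n hmn
  have hmn : doubledCoord f m = doubledCoord f n := hmn
  have h1 : f ((m / 2 : ℕ) : ℤ) = f ((n / 2 : ℕ) : ℤ) := by
    have := congrArg abs hmn
    rw [abs_doubledCoord (hf _), abs_doubledCoord (hf _)] at this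
    exact_mod_cast add_right_cancel this
  have h2 : (m / 2 : ℕ) = (n / 2 : ℕ) := by
    have := hinj _ _ (by omega) (by omega) (by omega) (by omega) h1
    exact_mod_cast this
  have h3 : (-1 : ℝ) ^ (m : ℕ) = (-1) ^ (n : ℕ) := by
    rw [doubledCoord, doubledCoord, h1] at hmn
    have h0 : (0 : ℝ) ≤ f ((n / 2 : ℕ) : ℤ) := by exact_mod_cast hf _
    exact mul_right_cancel₀ (by linarith) hmn
  have h4 : (m : ℕ) % 2 = (n : ℕ) % 2 := by
    rcases Nat.even_or_odd (m : ℕ) with hm | hm <;> rcases Nat.even_or_odd (n : ℕ) with hn | hn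
    · rw [Nat.even_iff.1 hm, Nat.even_iff.1 hn]
    · rw [hm.neg_one_pow, hn.neg_one_pow] at h3
      norm_num at h3
    · rw [hm.neg_one_pow, hn.neg_one_pow] at h3
      norm_num at h3
    · rw [Nat.odd_iff.1 hm, Nat.odd_iff.1 hn]
  ext
  omega

/-- The subgraph of a complete bipartite graph whose edges are given by a relation. -/
def bipartiteSubgraph {X Y : Type*} (Q : X → Y → Prop) :
    (completeBipartiteGraph X Y).Subgraph where
  verts := univ
  Adj u v := (∃ x y, u = Sum.inl x ∧ v = Sum.inr y ∧ Q x y) ∨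
    ∃ x y, v = Sum.inl x ∧ u = Sum.inr y ∧ Q x y
  adj_sub := by
    rintro u v (⟨x, y, rfl, rfl, -⟩ | ⟨x, y, rfl, rfl, -⟩) <;> simp
  edge_vert _ := mem_univ _
  symm := ⟨fun _ _ h => h.symm⟩

theorem bipartiteSubgraph_adj {X Y : Type*} {Q : X → Y → Prop} {x : X} {y : Y} :
    (bipartiteSubgraph Q).Adj (Sum.inl x) (Sum.inr y) ↔ Q x y := by
  simp [bipartiteSubgraph]

/-- A decomposition of `K_{2a,2b}` into planar subgraphs. -/
theorem isUnionOfPlanar_completeBipartiteGraph {a b t : ℕ} (ht : 0 < t) (htb : t ≤ b)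
    (hab : (a * b : ℤ) ≤ t * (a + b - 1)) :
    IsUnionOfPlanar (completeBipartiteGraph (Fin (2 * a)) (Fin (2 * b))) t := by
  have ht' : (0 : ℤ) < t := by exact_mod_cast ht
  have htb' : (t : ℤ) ≤ b := by exact_mod_cast htb
  have hb : (0 : ℤ) < b := ht'.trans_le htb'
  let Q : Fin t → Fin (2 * a) → Fin (2 * b) → Prop := fun k x y =>
    StairCell b t (k : ℕ) ((x / 2 : ℕ) : ℤ) ((y / 2 : ℕ) : ℤ)
  refine ⟨fun k => bipartiteSubgraph (Q k), fun k => ?_, ?_⟩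
  -- Rows keep their natural order. The truncation only serves to make the coordinate nonnegative on
  -- all integers.
  · let g : ℤ → ℤ := fun i => max i 0
    have hg0 : ∀ i, 0 ≤ g i := fun i => le_max_right _ _
    have hg : ∀ n : ℕ, g n = n := fun n => max_eq_left (by omega)
    have hc0 : ∀ c, 0 ≤ stairColumn b t (k : ℕ) c := fun c => stairColumn_nonneg hb _ _
    refine isPlanar_of_monotone (ξ := fun x => doubledCoord g x)
      (η := fun y => doubledCoord (stairColumn b t (k : ℕ)) y) _ ?_ ?_ ?_ ?_ ?_
    · exact doubledCoord_injective hg0 fun c c' h1 _ h2 _ h => by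
        simpa only [g, max_eq_left h1, max_eq_left h2] using h
    · exact doubledCoord_injective hc0 fun c c' h1 h2 h3 h4 h => stairColumn_injOn _ h1 h2 h3 h4 h
    · exact fun x => doubledCoord_ne_zero (hg0 _)
    · exact fun y => doubledCoord_ne_zero (hc0 _)
    · intro x y x' y' h h' hlt
      rw [bipartiteSubgraph_adj] at h h'
      rw [abs_doubledCoord (hg0 _), abs_doubledCoord (hg0 _), hg, hg] at hlt
      rw [abs_doubledCoord (hc0 _), abs_doubledCoord (hc0 _)]
      have hlt' : (((x / 2 : ℕ) : ℤ) : ℝ) < ((x' / 2 : ℕ) : ℤ) := by linarith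
      have := StairCell.mono ht' htb' h h' (by exact_mod_cast hlt')
      have : (stairColumn b t (k : ℕ) ((y / 2 : ℕ) : ℤ) : ℝ) ≤
        stairColumn b t (k : ℕ) ((y' / 2 : ℕ) : ℤ) := by exact_mod_cast this
      linarith
  · have hcov : ∀ (x : Fin (2 * a)) (y : Fin (2 * b)), ∃ k, Q k x y := by
      intro x y
      obtain ⟨k, hk0, hkt, hk⟩ := exists_stairCell ht' htb' hab (i := ((x / 2 : ℕ) : ℤ)) (by omega)
        (by omega) ((y / 2 : ℕ) : ℤ)
      lift k to ℕ using hk0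
      exact ⟨⟨k, by exact_mod_cast hkt⟩, hk⟩
    rw [eq_top_iff]
    refine ⟨fun u _ => ?_, fun u v huv => ?_⟩
    · rw [SimpleGraph.Subgraph.verts_iSup]
      exact mem_iUnion.2 ⟨⟨0, ht⟩, mem_univ _⟩
    · rw [SimpleGraph.Subgraph.iSup_adj]
      rw [SimpleGraph.Subgraph.top_adj] at huv
      rcases u with x | y <;> rcases v with x' | y'
      · simp at huv
      · obtain ⟨k, hk⟩ := hcov x y'
        exact ⟨k, bipartiteSubgraph_adj.2 hk⟩
      · obtain ⟨k, hk⟩ := hcov x' y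
        exact ⟨k, (bipartiteSubgraph_adj.2 hk).symm⟩
      · simp at huv

end UpperBound

end GraphThickness

/-! ### The two bounds combined -/

theorem corollary2 (n₁ n₂ : ℕ) (h₁ : 1 ≤ n₁) (h₂ : 1 ≤ n₂) :
    GraphThickness.thickness (completeBipartiteGraph (Fin (2 * n₁)) (Fin (2 * n₂))) =
      ((⌈((n₁ : ℝ) * (n₂ : ℝ)) / ((n₁ : ℝ) + (n₂ : ℝ) - 1)⌉₊ : ℕ) : ℕ∞) := by
  have r1 : (1 : ℝ) ≤ n₁ := by exact_mod_cast h₁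
  have r2 : (1 : ℝ) ≤ n₂ := by exact_mod_cast h₂
  have hpos : (0 : ℝ) < n₁ + n₂ - 1 := by linarith
  apply le_antisymm
  · refine iInf₂_le _ (GraphThickness.isUnionOfPlanar_completeBipartiteGraph ?_ ?_ ?_)
    · exact Nat.ceil_pos.2 (by positivity)
    -- There are at most as many staircases as columns, since `n₁ ≤ n₁ + n₂ - 1`.
    · rw [Nat.ceil_le, div_le_iff₀ hpos]
      nlinarith
    · have := Nat.le_ceil (((n₁ : ℝ) * (n₂ : ℝ)) / ((n₁ : ℝ) + (n₂ : ℝ) - 1))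
      rw [div_le_iff₀ hpos] at this
      exact_mod_cast this
  · refine le_iInf₂ fun k hk => ?_
    have : Nonempty (Fin (2 * n₁)) := ⟨⟨0, by omega⟩⟩
    have : Nonempty (Fin (2 * n₂)) := ⟨⟨0, by omega⟩⟩
    have h := GraphThickness.card_mul_card_le_of_isUnionOfPlanar (by
      rw [Fintype.card_fin, Fintype.card_fin]; omega) hk
    rw [Fintype.card_fin, Fintype.card_fin] at h
    rw [Nat.cast_le, Nat.ceil_le, div_le_iff₀ hpos]
    -- The truncated subtraction is exact because the minuend is at least 8; `d` equals `4 * (n₁ +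
    -- n₂ - 1)`.
    obtain ⟨d, hd⟩ : ∃ d, 2 * (2 * n₁ + 2 * n₂) - 4 = d := ⟨_, rfl⟩
    rw [hd] at h
    have hd' : (d : ℝ) + 4 = 2 * (2 * n₁ + 2 * n₂) := by
      have : d + 4 = 2 * (2 * n₁ + 2 * n₂) := by omega
      exact_mod_cast this
    have h' : (2 * n₁ : ℝ) * (2 * n₂) ≤ k * d := by exact_mod_cast h
    have hd'' : (d : ℝ) = 4 * (n₁ + n₂ - 1) := by linarith
    rw [hd''] at h'
    linarith
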